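/- Let $M\ge 1$, $T>0$, $\kappa>0$, $\alpha_1,\dots,\alpha_M\in\mathbb R$. Let the net load $\ell:[0,T]\to\mathbb R$ be $C^1$, and let $c_1,\dots,c_M,c_g:\mathbb R\to\mathbb R$ be non-negative, $C^2$ and strongly convex (all second derivatives are $\ge\mu$ for some $\mu>0$). Put $c_d(v)=\kappa v^2$, and write $y_\sigma=\sum_i y_i$ for $y\in\mathbb R^M$. For $(x_0,z_0)\in\mathbb R^M\times\mathbb R^M$ and $t_0\in[0,T]$ let $$J^\star(x_0,z_0,t_0)=\inf_u\int_{t_0}^T\Big[\sum_i c_i(x_i)+c_g(\ell-z_\sigma)+c_d(u_\sigma-\dot\ell)\Big]dt ,$$ the infimum being over continuous $u:[t_0,T]\to\mathbb R^M$, with $\dot x_i=-\alpha_i x_i-z_i$, $\dot z_i=u_i$, $x(t_0)=x_0$, $z(t_0)=z_0$; and let $K^\star(r,s,t_0)=\inf\{J^\star(x,z,t_0): x_\sigma=r,\ z_\sigma=s\}$. An optimal solution from $(x_0,z_0)$ at time $t_0<T$ is a triple $(x^\star,z^\star,u^\star)$ on $(t_0,T]$ that satisfies these differential equations, with $x^\star,z^\star$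 of class $C^1$ on $(t_0,T]$ and having right limits at $t_0$ with $x^\star_\sigma(t_0+)=(x_0)_\sigma$, $z^\star_\sigma(t_0+)=(z_0)_\sigma$, and whose cost integral over $(t_0,T]$ exists and equals $J^\star(x_0,z_0,t_0)$ (so the individual components may jump at $t_0$). Assume that for all $t_0\in[0,T)$ and all $(x_0,z_0)$ there is exactly one optimal solution, and that $K^\star$ is $C^1$ on $\mathbb R\times\mathbb R\times[0,T]$. Fix $(x_0,z_0)$, let $(x^\star,z^\star,u^\star)$ be the optimal solution from $(x_0,z_0)$ at time $0$, put $$\lambda^\star(t)=\partial_r K^\star\big(x^\star_\sigma(t),z^\star_\sigma(t),t\big),\qquad 0<t\le T,$$ and assume that $\lambda^\star$ is $C^2$ on $(0,T]$. For integrable $\varrho$ on $(0,T]$ define the dual functional $$\phi^\star(\varrho)=\inf\int_0^T\Big[c_g(g)+c_d(\gamma)+\sum_i c_i(x_i)+\varrho\,(\ell-g-z_\sigma)\Big]dt\in[-\infty,\infty),$$ the infimum being over $u$, $\gamma$ continuous on $[0,T]$, with $\dot g=\gamma$, $\dot x_i=-\alpha_i x_i-z_i$, $\dot z_i=u_i$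 on $[0,T]$ and given initial conditions $x(0)=x_0$, $z(0)=z_0$, $g(0)=\ell(0)-(z_0)_\sigma$. Then $\varrho^\star(t)=-\lambda^\star(t)$, $t\in(0,T]$, is integrable and maximizes $\phi^\star$ over all integrable $\varrho$, and there is no duality gap: $\phi^\star(\varrho^\star)=J^\star(x_0,z_0,0)$. Moreover $\varrho^\star$ is the dynamic competitive equilibrium price for the optimal allocation $g^\star=\ell-z^\star_\sigma$, $(x^\star,z^\star)$, in the following sense. (i) $\ell=g^\star+z^\star_\sigma$ on $(0,T]$. (ii) $g^\star$ is the unique maximizer of $\int_0^T[-c_g(g)-c_d(\dot g)+\varrho^\star g]\,dt$ over all $C^1$ functions $g$ on $[0,T]$ with $g(0)=\ell(0)-(z_0)_\sigma$; here $g^\star$, extended to $0$ by its right limit, is itself such a function. (iii) The limit $\varrho^\star(0+)$ exists, and for each $i$ the pair $(x_i^\star,z_i^\star)$ is the unique maximizer of $$\int_0^T[-c_i(x_i)+\varrho^\star z_i]\,dt-\varrho^\star(0+)\,\big(x_i(0+)-(x_0)_i\big)$$ over all pairs $(x_i,z_i)$ on $(0,T]$ with $z_i$ continuous, $\dot x_i=-\alpha_ix_i-z_i$,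 and both having right limits at $0$. The last term is the contribution to $\int\varrho^\star z_i$ of the impulse in $z_i$ that moves the state from $(x_0)_i$ to $x_i(0+)$ at time $0$; among pairs with $x_i(0+)=x_i^\star(0+)$ it is a constant. -/

import Mathlib

open Set Filter Topology MeasureTheory

noncomputable section

/-- Data of the resource allocation problem with `M` load classes. -/
structure GridModel (M : ℕ) where
  /-- time horizon -/
  T : ℝ
  /-- leakage rates of the load classes -/
  α : Fin M → ℝ
  /-- net load -/
  ℓ : ℝ → ℝ
  /-- cost on the state of charge of each load class -/
  c : Fin M → ℝ → ℝ
  /-- generation cost -/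
  cg : ℝ → ℝ
  /-- coefficient of the quadratic ramping cost -/
  κ : ℝ

namespace GridModel

variable {M : ℕ} (P : GridModel M)

/-- The quadratic ramping cost. -/
def cd (v : ℝ) : ℝ := P.κ * v ^ 2

/-- The total cost on the states of charge. -/
def cX (x : Fin M → ℝ) : ℝ := ∑ i, P.c i (x i)

/-- The time derivative of the net load on `[0, T]` (one-sided at the end points). -/
def dℓ (t : ℝ) : ℝ := derivWithin P.ℓ (Icc 0 P.T) t

/-- Basic assumptions on the data: the net load is `C¹` on `[0, T]`; all state costs and the
generation cost are non-negative, `C²` and strongly convex; the ramping cost is non-degenerate. -/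
structure Regular : Prop where
  T_pos : 0 < P.T
  κ_pos : 0 < P.κ
  ℓ_C1 : ContDiffOn ℝ 1 P.ℓ (Icc 0 P.T)
  c_nonneg : ∀ i y, 0 ≤ P.c i y
  cg_nonneg : ∀ y, 0 ≤ P.cg y
  c_C2 : ∀ i, ContDiff ℝ 2 (P.c i)
  cg_C2 : ContDiff ℝ 2 P.cg
  strongly_convex : ∃ μ : ℝ, 0 < μ ∧ (∀ i y, μ ≤ deriv (deriv (P.c i)) y) ∧
    ∀ y, μ ≤ deriv (deriv P.cg) y

/-- Running cost after elimination of the generation `g = ℓ - z_σ` and its ramp. -/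
def runningCost (x z u : Fin M → ℝ) (t : ℝ) : ℝ :=
  P.cX x + P.cg (P.ℓ t - ∑ i, z i) + P.cd ((∑ i, u i) - P.dℓ t)

/-- Total cost over `[t₀, T]`. -/
def totalCost (t₀ : ℝ) (x z u : ℝ → Fin M → ℝ) : ℝ :=
  ∫ t in t₀..P.T, P.runningCost (x t) (z t) (u t) t

/-- `(x, z)` is the state trajectory on `[t₀, T]` with initial value `(x₀, z₀)` for the
continuous input `u`. -/
structure IsAdmissible (t₀ : ℝ) (x₀ z₀ : Fin M → ℝ) (x z u : ℝ → Fin M → ℝ) : Prop where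
  u_cont : ContinuousOn u (Icc t₀ P.T)
  x_init : x t₀ = x₀
  z_init : z t₀ = z₀
  x_dyn : ∀ t ∈ Icc t₀ P.T, ∀ i,
    HasDerivWithinAt (fun s => x s i) (-P.α i * x t i - z t i) (Icc t₀ P.T) t
  z_dyn : ∀ t ∈ Icc t₀ P.T, ∀ i,
    HasDerivWithinAt (fun s => z s i) (u t i) (Icc t₀ P.T) t

/-- The cost-to-go `J⋆`. -/
def J (x₀ z₀ : Fin M → ℝ) (t₀ : ℝ) : ℝ :=
  sInf {v | ∃ x z u, P.IsAdmissible t₀ x₀ z₀ x z u ∧ v = P.totalCost t₀ x z u}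

/-- The value function `K⋆` of the aggregate state. -/
def K (r s t₀ : ℝ) : ℝ :=
  sInf {v | ∃ x z : Fin M → ℝ, ∑ i, x i = r ∧ ∑ i, z i = s ∧ v = P.J x z t₀}

/-- `K⋆` is continuously differentiable on `ℝ × ℝ × [0, T]`. -/
def ValueC1 : Prop :=
  ContDiffOn ℝ 1 (fun p : ℝ × ℝ × ℝ => P.K p.1 p.2.1 p.2.2) {p | p.2.2 ∈ Icc 0 P.T}

/-- An optimal solution on `(t₀, T]`. The input carries no individual cost, so the optimal state
may jump at `t₀`: only the sums of the components of `x` and of `z` are tied to the given initial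
state `(x₀, z₀)`. Optimality means that the value `J⋆(x₀, z₀, t₀)` is attained. -/
structure IsOptimal (t₀ : ℝ) (x₀ z₀ : Fin M → ℝ) (x z u : ℝ → Fin M → ℝ) : Prop where
  x_C1 : ContDiffOn ℝ 1 x (Ioc t₀ P.T)
  z_C1 : ContDiffOn ℝ 1 z (Ioc t₀ P.T)
  x_dyn : ∀ t ∈ Ioc t₀ P.T, ∀ i,
    HasDerivWithinAt (fun s => x s i) (-P.α i * x t i - z t i) (Ioc t₀ P.T) t
  z_dyn : ∀ t ∈ Ioc t₀ P.T, ∀ i,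
    HasDerivWithinAt (fun s => z s i) (u t i) (Ioc t₀ P.T) t
  x_lim : ∃ a : Fin M → ℝ, Tendsto x (𝓝[>] t₀) (𝓝 a) ∧ ∑ i, a i = ∑ i, x₀ i
  z_lim : ∃ b : Fin M → ℝ, Tendsto z (𝓝[>] t₀) (𝓝 b) ∧ ∑ i, b i = ∑ i, z₀ i
  cost_integrable :
    IntervalIntegrable (fun t => P.runningCost (x t) (z t) (u t) t) volume t₀ P.T
  cost_eq : P.totalCost t₀ x z u = P.J x₀ z₀ t₀

/-- For every initial time and initial state there is exactly one optimal solution. -/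
def UniquelySolvable : Prop :=
  ∀ t₀ ∈ Ico 0 P.T, ∀ x₀ z₀ : Fin M → ℝ, ∃ x z u, P.IsOptimal t₀ x₀ z₀ x z u ∧
    ∀ x' z' u', P.IsOptimal t₀ x₀ z₀ x' z' u' →
      EqOn x' x (Ioc t₀ P.T) ∧ EqOn z' z (Ioc t₀ P.T) ∧ EqOn u' u (Ioc t₀ P.T)

/-- `λ⋆(t)`: the partial derivative of `K⋆` in its first variable along the trajectory. -/
def costate (x z : ℝ → Fin M → ℝ) (t : ℝ) : ℝ :=
  deriv (fun r => P.K r (∑ i, z t i) t) (∑ i, x t i)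

/-! ### The Lagrangian relaxation of the power balance -/

/-- Feasibility in the relaxed problem: all constraints except the power balance `ℓ = g + z_σ`.
The initial state `(x₀, z₀)` is given, and with it the initial generation `ℓ(0) - z_σ(0)`. -/
structure IsRelaxedFeasible (x₀ z₀ : Fin M → ℝ) (g γ : ℝ → ℝ) (x z u : ℝ → Fin M → ℝ) :
    Prop where
  γ_cont : ContinuousOn γ (Icc 0 P.T)
  g_init : g 0 = P.ℓ 0 - ∑ i, z₀ i
  g_dyn : ∀ t ∈ Icc 0 P.T, HasDerivWithinAt g (γ t) (Icc 0 P.T) t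
  loads : P.IsAdmissible 0 x₀ z₀ x z u

/-- The Lagrangian with multiplier `ϱ` for the power balance. -/
def lagrangian (ϱ g γ : ℝ → ℝ) (x z : ℝ → Fin M → ℝ) : ℝ :=
  ∫ t in 0..P.T, (P.cg (g t) + P.cd (γ t) + P.cX (x t) + ϱ t * (P.ℓ t - g t - ∑ i, z t i))

/-- The dual functional `φ⋆`; it may take the value `-∞`. -/
def dual (x₀ z₀ : Fin M → ℝ) (ϱ : ℝ → ℝ) : EReal :=
  sInf {v | ∃ g γ x z u, P.IsRelaxedFeasible x₀ z₀ g γ x z u ∧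
    v = ((P.lagrangian ϱ g γ x z : ℝ) : EReal)}

/-- Multipliers: the functions `ϱ` for which the Lagrangian integrals make sense. -/
def IsMultiplier (ϱ : ℝ → ℝ) : Prop := IntervalIntegrable ϱ volume 0 P.T

/-! ### Competitive equilibrium -/

/-- A generation schedule on `(0, T]` with initial value `g₀`; it is the restriction of a `C¹`
function on `[0, T]`. -/
structure IsGeneration (g₀ : ℝ) (g γ : ℝ → ℝ) : Prop where
  γ_cont : ContinuousOn γ (Ioc 0 P.T)
  γ_lim : ∃ b, Tendsto γ (𝓝[>] 0) (𝓝 b)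
  g_lim : Tendsto g (𝓝[>] 0) (𝓝 g₀)
  g_dyn : ∀ t ∈ Ioc 0 P.T, HasDerivWithinAt g (γ t) (Ioc 0 P.T) t

/-- The supplier's profit at price `ϱ`. -/
def supplierPayoff (ϱ g γ : ℝ → ℝ) : ℝ :=
  ∫ t in 0..P.T, (-P.cg (g t) - P.cd (γ t) + ϱ t * g t)

/-- A trajectory on `(0, T]` of load class `i` that starts at the state of charge `a`. -/
structure IsLoad (i : Fin M) (a : ℝ) (x z : ℝ → ℝ) : Prop where
  z_cont : ContinuousOn z (Ioc 0 P.T)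
  z_lim : ∃ b, Tendsto z (𝓝[>] 0) (𝓝 b)
  x_lim : Tendsto x (𝓝[>] 0) (𝓝 a)
  x_dyn : ∀ t ∈ Ioc 0 P.T, HasDerivWithinAt x (-P.α i * x t - z t) (Ioc 0 P.T) t

/-- The payoff of load class `i` at price `ϱ`, with `p = ϱ(0+)`, on a trajectory which jumps at
time zero from the given state of charge `x₀` to `a`. As `dx/dt = -α x - z`, the jump is an impulse
of mass `-(a - x₀)` in `z` at time zero, which adds `-p (a - x₀)` to the integral of `ϱ z`. -/
def loadPayoff (i : Fin M) (x₀ p a : ℝ) (ϱ x z : ℝ → ℝ) : ℝ :=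
  (∫ t in 0..P.T, (-P.c i (x t) + ϱ t * z t)) - p * (a - x₀)

/-- At the price `ϱ` the allocation `(g, γ, x, z)` is a dynamic competitive equilibrium: supply and
demand balance, the generation schedule is the unique best choice of the supplier, and the
trajectory of each load class is its unique best choice. -/
structure IsEquilibrium (x₀ z₀ : Fin M → ℝ) (ϱ g γ : ℝ → ℝ) (x z : ℝ → Fin M → ℝ) : Prop where
  balance : ∀ t ∈ Ioc 0 P.T, P.ℓ t = g t + ∑ i, z t i
  generation : P.IsGeneration (P.ℓ 0 - ∑ i, z₀ i) g γ
  supplier_max : ∀ g' γ', P.IsGeneration (P.ℓ 0 - ∑ i, z₀ i) g' γ' →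
    P.supplierPayoff ϱ g' γ' ≤ P.supplierPayoff ϱ g γ ∧
    (P.supplierPayoff ϱ g' γ' = P.supplierPayoff ϱ g γ → EqOn g' g (Ioc 0 P.T))
  load_max : ∃ p, Tendsto ϱ (𝓝[>] 0) (𝓝 p) ∧ ∀ i, ∃ a,
    P.IsLoad i a (fun t => x t i) (fun t => z t i) ∧
    ∀ a' x' z', P.IsLoad i a' x' z' →
      P.loadPayoff i (x₀ i) p a' ϱ x' z' ≤
        P.loadPayoff i (x₀ i) p a ϱ (fun t => x t i) (fun t => z t i) ∧
      (P.loadPayoff i (x₀ i) p a' ϱ x' z' =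
          P.loadPayoff i (x₀ i) p a ϱ (fun t => x t i) (fun t => z t i) →
        EqOn x' (fun t => x t i) (Ioc 0 P.T) ∧ EqOn z' (fun t => z t i) (Ioc 0 P.T))

end GridModel

end

/-! The input is priced only through `u_σ` and `z` only through `z_σ`, while a bounded displacement
of `x` that lasts a short time costs little. An initial layer of width about `1/n` can therefore
rearrange the individual loads, one of them compensating so that `z_σ` and `u_σ` do not change, and
its cost tends to zero. So `J` depends on the initial state only through its sums (`K_eq_J`).
Concatenation (`IsAdmissible.J_le_integral_add_J`) and continuity of `K` at time `0` then show that
every tail of the optimal solution attains `K`, in spite of the jump (`IsOptimal.K_eq_totalCost`).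

Along a family of perturbations, cost minus `K` is minimal at the optimum, so its derivative
vanishes (`IsOptimal.first_variation`). Displacing one load `k` alone gives `λ⋆(t) = ∫_t^T c_k'(x_k)
exp(-α_k (τ - t)) dτ` (`IsOptimal.costate_eq`). The left side does not depend on `k`: all loads
share one costate `Λ`, with `Λ' = α_i Λ - c_i'(x_i)` for every `i` and `Λ(T) = 0`, and it extends
continuously to time `0`. Varying the input gives the Euler-Lagrange equation `F' = Λ + c_g'(g)`, `F
= c_d'(ġ)`, `F(T) = 0` (`IsOptimal.exists_isExtremal`).

For the price `-Λ` these are the stationarity conditions of the supplier and of each load. Convexity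
makes them sufficient, and strong convexity gives uniqueness (`IsExtremal.supplier_bound`,
`IsExtremal.load_bound`); the impulse term in a load's payoff is what cancels the boundary term
`Λ(0) x_i(0+)`. The Lagrangian splits into these payoffs (`IsExtremal.lagrangian_eq`). Since the
jumps of the loads sum to zero, the impulse terms cancel in total, so the Lagrangian is at least `J`
on the relaxed feasible set. With weak duality (`dual_le_J`) there is no gap. -/

namespace GridModel

/-! ### Calculus on compact intervals: linear equations, bounded convergence, first variations,
convexity. -/

section Analysis

variable {a b : ℝ}

lemma _root_.ContinuousOn.intervalIntegrable_Icc {f : ℝ → ℝ} (hab : a ≤ b)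
    (hf : ContinuousOn f (Icc a b)) : IntervalIntegrable f volume a b :=
  ContinuousOn.intervalIntegrable (by rwa [uIcc_of_le hab])

lemma aestronglyMeasurable_uIoc {f : ℝ → ℝ} (hab : a ≤ b) (hf : ContinuousOn f (Icc a b)) :
    AEStronglyMeasurable f (volume.restrict (Set.uIoc a b)) := by
  rw [uIoc_of_le hab]
  exact (hf.mono Ioc_subset_Icc_self).aestronglyMeasurable measurableSet_Ioc

lemma integral_congr_Ioc {f g : ℝ → ℝ} (hab : a ≤ b) (h : EqOn f g (Ioc a b)) :
    ∫ t in a..b, f t = ∫ t in a..b, g t :=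
  intervalIntegral.integral_congr_ae
    (Eventually.of_forall fun t ht => h (by rwa [uIoc_of_le hab] at ht))

lemma hasDerivWithinAt_integral {f : ℝ → ℝ} (hf : ContinuousOn f (Icc a b)) {t : ℝ}
    (ht : t ∈ Icc a b) :
    HasDerivWithinAt (fun s => ∫ σ in a..s, f σ) (f t) (Icc a b) t := by
  have : Fact (t ∈ Icc a b) := ⟨ht⟩
  refine intervalIntegral.integral_hasDerivWithinAt_right ?_ ?_ (hf t ht)
  · exact (hf.mono (Icc_subset_Icc_right ht.2)).intervalIntegrable_Icc ht.1
  · exact ⟨Icc a b, self_mem_nhdsWithin, hf.aestronglyMeasurable measurableSet_Icc⟩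

lemma hasDerivWithinAt_integral_left {f : ℝ → ℝ} (hf : ContinuousOn f (Icc a b)) {t : ℝ}
    (ht : t ∈ Icc a b) :
    HasDerivWithinAt (fun s => ∫ σ in s..b, f σ) (-f t) (Icc a b) t := by
  have : Fact (t ∈ Icc a b) := ⟨ht⟩
  refine intervalIntegral.integral_hasDerivWithinAt_left ?_ ?_ (hf t ht)
  · exact (hf.mono (Icc_subset_Icc_left ht.1)).intervalIntegrable_Icc ht.2
  · exact ⟨Icc a b, self_mem_nhdsWithin, hf.aestronglyMeasurable measurableSet_Icc⟩

/-- The solution of `q' = -α q + f` with `q a = 0`. -/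
noncomputable def linSol (α : ℝ) (f : ℝ → ℝ) (a t : ℝ) : ℝ :=
  Real.exp (-α * t) * ∫ σ in a..t, Real.exp (α * σ) * f σ

lemma linSol_left (α : ℝ) (f : ℝ → ℝ) (a : ℝ) : linSol α f a a = 0 := by simp [linSol]

lemma hasDerivWithinAt_linSol (α : ℝ) {f : ℝ → ℝ} (hf : ContinuousOn f (Icc a b)) {t : ℝ}
    (ht : t ∈ Icc a b) :
    HasDerivWithinAt (linSol α f a) (-α * linSol α f a t + f t) (Icc a b) t := by
  have h1 : HasDerivAt (fun t => Real.exp (-α * t)) (Real.exp (-α * t) * (-α)) t := by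
    simpa using ((hasDerivAt_id t).const_mul (-α)).exp
  have hc : ContinuousOn (fun σ => Real.exp (α * σ) * f σ) (Icc a b) :=
    (by fun_prop : Continuous fun σ => Real.exp (α * σ)).continuousOn.mul hf
  have h2 := h1.hasDerivWithinAt.mul (hasDerivWithinAt_integral hc ht)
  refine h2.congr_deriv ?_
  have : Real.exp (-α * t) * Real.exp (α * t) = 1 := by rw [← Real.exp_add]; simp
  simp only [linSol]
  linear_combination f t * this

lemma linSol_bound (α : ℝ) {f : ℕ → ℝ → ℝ} {B : ℝ} (hB : ∀ n, ∀ t ∈ Icc a b, |f n t| ≤ B) :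
    ∃ C, ∀ n, ∀ t ∈ Icc a b, |linSol α (f n) a t| ≤ C := by
  obtain ⟨E, hE⟩ := isCompact_Icc.exists_bound_of_continuousOn (s := Icc a b)
    (f := fun t => Real.exp (-α * t)) (by fun_prop)
  obtain ⟨E', hE'⟩ := isCompact_Icc.exists_bound_of_continuousOn (s := Icc a b)
    (f := fun t => Real.exp (α * t)) (by fun_prop)
  refine ⟨E * (E' * B * (b - a)), fun n t ht => ?_⟩
  have hE0 : 0 ≤ E := (norm_nonneg _).trans (hE t ht)
  have hE0' : 0 ≤ E' := (norm_nonneg _).trans (hE' t ht)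
  have hB0 : 0 ≤ B := (abs_nonneg _).trans (hB n t ht)
  have : ‖∫ σ in a..t, Real.exp (α * σ) * f n σ‖ ≤ E' * B * |t - a| := by
    refine intervalIntegral.norm_integral_le_of_norm_le_const fun σ hσ => ?_
    rw [uIoc_of_le ht.1] at hσ
    have hσ' : σ ∈ Icc a b := ⟨hσ.1.le, hσ.2.trans ht.2⟩
    rw [norm_mul]
    exact mul_le_mul (hE' σ hσ') (hB n σ hσ') (norm_nonneg _) hE0'
  rw [linSol, abs_mul]
  refine mul_le_mul (hE t ht) (this.trans ?_) (abs_nonneg _) hE0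
  rw [abs_of_nonneg (by linarith [ht.1])]
  gcongr
  exact ht.2

/-- Bounded pointwise convergence to zero on `(a, b]`. -/
structure IsVanishing (a b : ℝ) (f : ℕ → ℝ → ℝ) : Prop where
  cont : ∀ n, ContinuousOn (f n) (Icc a b)
  bdd : ∃ B, ∀ n, ∀ t ∈ Icc a b, |f n t| ≤ B
  tendsto : ∀ t ∈ Ioc a b, Tendsto (fun n => f n t) atTop (𝓝 0)

namespace IsVanishing

variable {f g : ℕ → ℝ → ℝ}

lemma add (hf : IsVanishing a b f) (hg : IsVanishing a b g) :
    IsVanishing a b (fun n t => f n t + g n t) where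
  cont n := (hf.cont n).add (hg.cont n)
  bdd := by
    obtain ⟨B, hB⟩ := hf.bdd
    obtain ⟨C, hC⟩ := hg.bdd
    exact ⟨B + C, fun n t ht => (abs_add_le _ _).trans (add_le_add (hB n t ht) (hC n t ht))⟩
  tendsto t ht := by simpa using (hf.tendsto t ht).add (hg.tendsto t ht)

lemma mul {h : ℝ → ℝ} (hh : ContinuousOn h (Icc a b)) (hf : IsVanishing a b f) :
    IsVanishing a b (fun n t => h t * f n t) where
  cont n := hh.mul (hf.cont n)
  bdd := by
    obtain ⟨B, hB⟩ := hf.bdd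
    obtain ⟨C, hC⟩ := isCompact_Icc.exists_bound_of_continuousOn hh
    refine ⟨C * B, fun n t ht => ?_⟩
    rw [abs_mul]
    exact mul_le_mul (hC t ht) (hB n t ht) (abs_nonneg _) ((norm_nonneg _).trans (hC t ht))
  tendsto t ht := by simpa using (hf.tendsto t ht).const_mul (h t)

lemma const_mul (r : ℝ) (hf : IsVanishing a b f) : IsVanishing a b (fun n t => r * f n t) :=
  hf.mul continuousOn_const

lemma zero : IsVanishing a b (fun _ _ => 0) where
  cont _ := continuousOn_const
  bdd := ⟨0, by simp⟩
  tendsto _ _ := tendsto_const_nhds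

lemma sum {ι : Type*} (s : Finset ι) {f : ι → ℕ → ℝ → ℝ} (hf : ∀ i, IsVanishing a b (f i)) :
    IsVanishing a b (fun n t => ∑ i ∈ s, f i n t) := by
  induction s using Finset.cons_induction with
  | empty => simpa using zero
  | cons i s hi ih => simpa using (hf i).add ih

/-- With `s = n (t - a) ≥ 0`, the bound `k!` is `s ^ k / k! ≤ exp s`. For `k = 0` the value at `t =
a` is `1` for every `n`, so convergence can only be asked on `(a, b]`. -/
lemma pow_mul_exp (k : ℕ) :
    IsVanishing a b (fun n t => (n * (t - a)) ^ k * Real.exp (-(n * (t - a)))) where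
  cont n := by fun_prop
  bdd := by
    refine ⟨k.factorial, fun n t ht => ?_⟩
    have h0 : 0 ≤ n * (t - a) := mul_nonneg n.cast_nonneg (by linarith [ht.1])
    have := Real.pow_div_factorial_le_exp _ h0 k
    rw [abs_of_nonneg (by positivity), Real.exp_neg, ← div_eq_mul_inv,
      div_le_iff₀ (Real.exp_pos _)]
    rw [div_le_iff₀ (by positivity)] at this
    linarith
  tendsto t ht := (Real.tendsto_pow_mul_exp_neg_atTop_nhds_zero k).comp
    (tendsto_natCast_atTop_atTop.atTop_mul_const (by linarith [ht.1]))

lemma tendsto_integral (hab : a ≤ b) (hf : IsVanishing a b f) :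
    Tendsto (fun n => ∫ t in a..b, f n t) atTop (𝓝 0) := by
  obtain ⟨B, hB⟩ := hf.bdd
  have := intervalIntegral.tendsto_integral_filter_of_dominated_convergence (μ := volume)
    (a := a) (b := b) (F := f) (f := fun _ => (0 : ℝ)) (l := atTop) (fun _ => B)
    (Eventually.of_forall fun n => aestronglyMeasurable_uIoc hab (hf.cont n))
    (Eventually.of_forall fun n => Eventually.of_forall fun t ht => by
      rw [uIoc_of_le hab] at ht; exact hB n t (Ioc_subset_Icc_self ht))
    intervalIntegrable_const
    (Eventually.of_forall fun t ht => by rw [uIoc_of_le hab] at ht; exact hf.tendsto t ht)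
  simpa using this

lemma linSol (α : ℝ) (hf : IsVanishing a b f) :
    IsVanishing a b (fun n => linSol α (f n) a) where
  cont n t ht := (hasDerivWithinAt_linSol α (hf.cont n) ht).continuousWithinAt
  bdd := by
    obtain ⟨B, hB⟩ := hf.bdd
    exact linSol_bound α hB
  tendsto t ht := by
    have hs : Icc a t ⊆ Icc a b := Icc_subset_Icc_right ht.2
    have h1 : IsVanishing a t f := by
      obtain ⟨B, hB⟩ := hf.bdd
      exact ⟨fun n => (hf.cont n).mono hs, ⟨B, fun n σ hσ => hB n σ (hs hσ)⟩,
        fun σ hσ => hf.tendsto σ ⟨hσ.1, hσ.2.trans ht.2⟩⟩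
    have := (h1.mul (h := fun σ => Real.exp (α * σ)) (by fun_prop)).tendsto_integral ht.1.le
    simpa [GridModel.linSol] using this.const_mul (Real.exp (-α * t))

end IsVanishing

/-- Composition with a continuous function is continuous under bounded convergence. -/
lemma tendsto_integral_comp_add {c : ℝ → ℝ} (hc : Continuous c) (hab : a ≤ b) {y : ℝ → ℝ}
    (hy : ContinuousOn y (Icc a b)) {f : ℕ → ℝ → ℝ} (hf : IsVanishing a b f) :
    Tendsto (fun n => ∫ t in a..b, c (y t + f n t)) atTop (𝓝 (∫ t in a..b, c (y t))) := by
  obtain ⟨B, hB⟩ := hf.bdd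
  obtain ⟨A, hA⟩ := isCompact_Icc.exists_bound_of_continuousOn hy
  obtain ⟨D, hD⟩ := (isCompact_Icc (a := -(A + B)) (b := A + B)).exists_bound_of_continuousOn
    hc.continuousOn
  refine intervalIntegral.tendsto_integral_filter_of_dominated_convergence (fun _ => D)
    (Eventually.of_forall fun n => aestronglyMeasurable_uIoc hab ?_)
    (Eventually.of_forall fun n => Eventually.of_forall fun t ht => ?_)
    intervalIntegrable_const (Eventually.of_forall fun t ht => ?_)
  · exact hc.comp_continuousOn (hy.add (hf.cont n))
  · rw [uIoc_of_le hab] at ht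
    have ht' := Ioc_subset_Icc_self ht
    have h1 := abs_le.1 (hA t ht')
    have h2 := abs_le.1 (hB n t ht')
    exact hD _ ⟨by linarith, by linarith⟩
  · rw [uIoc_of_le hab] at ht
    simpa [Function.comp_def] using (hc.tendsto _).comp ((hf.tendsto t ht).const_add (y t))

/-- First variation of an integral functional. -/
lemma hasDerivAt_integral_comp {c : ℝ → ℝ} (hc : ContDiff ℝ 1 c) (hab : a ≤ b) {y w : ℝ → ℝ}
    (hy : ContinuousOn y (Icc a b)) (hw : ContinuousOn w (Icc a b)) :
    HasDerivAt (fun ε => ∫ t in a..b, c (y t + ε * w t)) (∫ t in a..b, deriv c (y t) * w t) 0 := by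
  have hc' : Continuous (deriv c) := hc.continuous_deriv le_rfl
  obtain ⟨A, hA⟩ := isCompact_Icc.exists_bound_of_continuousOn hy
  obtain ⟨B, hB⟩ := isCompact_Icc.exists_bound_of_continuousOn hw
  obtain ⟨D, hD⟩ := (isCompact_Icc (a := -(A + B)) (b := A + B)).exists_bound_of_continuousOn
    hc'.continuousOn
  have hcont : ∀ ε : ℝ, ContinuousOn (fun t => y t + ε * w t) (Icc a b) := fun ε =>
    hy.add (continuousOn_const.mul hw)
  have := (intervalIntegral.hasDerivAt_integral_of_dominated_loc_of_deriv_le (μ := volume)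
    -- For `|ε| ≤ 1` the argument of `c'` stays in `[-(A + B), A + B]`, where `D` bounds `c'`.
    (a := a) (b := b) (F := fun ε t => c (y t + ε * w t))
    (F' := fun ε t => deriv c (y t + ε * w t) * w t) (x₀ := (0 : ℝ)) (s := Icc (-1) 1)
    (bound := fun _ => D * B) (Icc_mem_nhds (by norm_num) (by norm_num))
    (Eventually.of_forall fun ε =>
      aestronglyMeasurable_uIoc hab (hc.continuous.comp_continuousOn (hcont ε)))
    ((hc.continuous.comp_continuousOn (hcont 0)).intervalIntegrable_Icc hab)
    (aestronglyMeasurable_uIoc hab ((hc'.comp_continuousOn (hcont 0)).mul hw))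
    (Eventually.of_forall fun t ht ε hε => ?_) intervalIntegrable_const
    (Eventually.of_forall fun t ht ε hε => ?_)).2
  · simpa using this
  · rw [uIoc_of_le hab] at ht
    have ht' := Ioc_subset_Icc_self ht
    have h1 := abs_le.1 (hA t ht')
    have h3 : |ε * w t| ≤ B := by
      rw [abs_mul]
      exact (mul_le_of_le_one_left (abs_nonneg _) (abs_le.2 hε)).trans (hB t ht')
    have h2 := abs_le.1 h3
    have h4 := hD (y t + ε * w t) ⟨by linarith, by linarith⟩
    rw [norm_mul]
    exact mul_le_mul h4 (hB t ht') (norm_nonneg _) ((norm_nonneg _).trans h4)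
  · have h1 : HasDerivAt (fun ε => y t + ε * w t) (w t) ε := by
      simpa using ((hasDerivAt_id ε).mul_const (w t)).const_add (y t)
    exact ((hc.differentiable one_ne_zero _).hasDerivAt).comp ε h1

/-- Gluing differentiable functions whose values and derivatives match at the junction. -/
lemma hasDerivWithinAt_glue {f f' g g' : ℝ → ℝ} {m : ℝ} (ham : a ≤ m) (hmb : m ≤ b)
    (hf : ∀ t ∈ Icc a m, HasDerivWithinAt f (f' t) (Icc a m) t)
    (hg : ∀ t ∈ Icc m b, HasDerivWithinAt g (g' t) (Icc m b) t)
    (h : f m = g m) (h' : f' m = g' m) {t : ℝ} (ht : t ∈ Icc a b) :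
    HasDerivWithinAt (fun s => if s ≤ m then f s else g s) (if t ≤ m then f' t else g' t)
      (Icc a b) t := by
  have eg : EqOn (fun s => if s ≤ m then f s else g s) g (Icc m b) := fun s hs => by
    by_cases hsm : s ≤ m
    · obtain rfl : s = m := le_antisymm hsm hs.1
      simp [h]
    · simp [hsm]
  have ef : EqOn (fun s => if s ≤ m then f s else g s) f (Icc a m) := fun s hs => by
    simp [hs.2]
  rw [← Icc_union_Icc_eq_Icc ham hmb]
  refine HasDerivWithinAt.union ?_ ?_
  · by_cases htm : t ≤ m
    · rw [if_pos htm]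
      exact (hf t ⟨ht.1, htm⟩).congr ef (ef ⟨ht.1, htm⟩)
    · exact HasFDerivWithinAt.of_notMem_closure (by rw [closure_Icc]; exact fun h => htm h.2)
  · by_cases htm : m ≤ t
    · have : (if t ≤ m then f' t else g' t) = g' t := by
        by_cases hsm : t ≤ m
        · obtain rfl : t = m := le_antisymm hsm htm
          simp [h']
        · simp [hsm]
      rw [this]
      exact (hg t ⟨htm, ht.2⟩).congr eg (eg ⟨htm, ht.2⟩)
    · exact HasFDerivWithinAt.of_notMem_closure (by rw [closure_Icc]; exact fun h => htm h.1)

lemma continuousOn_glue {f g : ℝ → ℝ} {m : ℝ} (ham : a ≤ m) (hmb : m ≤ b)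
    (hf : ContinuousOn f (Icc a m)) (hg : ContinuousOn g (Icc m b)) (h : f m = g m) :
    ContinuousOn (fun s => if s ≤ m then f s else g s) (Icc a b) := by
  rw [← Icc_union_Icc_eq_Icc ham hmb]
  refine ContinuousOn.union_of_isClosed ?_ ?_ isClosed_Icc isClosed_Icc
  · exact hf.congr fun s hs => by simp [hs.2]
  · refine hg.congr fun s hs => ?_
    by_cases hsm : s ≤ m
    · obtain rfl : s = m := le_antisymm hsm hs.1
      simp [h]
    · simp [hsm]

/-- Optimal trajectories satisfy their equations only on `(0, T]`; continuity of the extension takes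
care of the left end point. -/
lemma integral_eq_sub_of_hasDerivWithinAt_Ioc {f f' : ℝ → ℝ} (hab : a ≤ b)
    (hf : ContinuousOn f (Icc a b)) (hf' : ContinuousOn f' (Icc a b))
    (hd : ∀ t ∈ Ioc a b, HasDerivWithinAt f (f' t) (Ioc a b) t) :
    ∫ t in a..b, f' t = f b - f a :=
  intervalIntegral.integral_eq_sub_of_hasDerivAt_of_le hab hf
    (fun t ht => (hd t ⟨ht.1, ht.2.le⟩).hasDerivAt (Ioc_mem_nhds ht.1 ht.2))
    (hf'.intervalIntegrable_Icc hab)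

lemma eqOn_zero_of_integral_sq_nonpos {f : ℝ → ℝ} (hab : a < b) (hf : ContinuousOn f (Icc a b))
    (h : ∫ t in a..b, f t ^ 2 ≤ 0) : ∀ t ∈ Icc a b, f t = 0 := by
  by_contra! hne
  obtain ⟨t, ht, hne⟩ := hne
  exact absurd h (not_le.2 (intervalIntegral.integral_pos hab (hf.pow 2)
    (fun _ _ => sq_nonneg _) ⟨t, ht, by positivity⟩))

/-- The difference `h` of `c` and the quadratic minorant has `h'' ≥ 0` and `h'(x) = 0`, so it is
convex with minimum `h(x) = 0`. -/
lemma add_deriv_mul_le_of_strongly_convex {c : ℝ → ℝ} (hc : ContDiff ℝ 2 c) {μ : ℝ}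
    (hμ : ∀ y, μ ≤ deriv (deriv c) y) (x y : ℝ) :
    c x + deriv c x * (y - x) + μ / 2 * (y - x) ^ 2 ≤ c y := by
  have hd : Differentiable ℝ c := hc.differentiable two_ne_zero
  have hc1 : ContDiff ℝ 1 (deriv c) := by
    have : ContDiff ℝ (1 + 1) c := by simpa [one_add_one_eq_two] using hc
    exact (contDiff_succ_iff_deriv.1 this).2.2
  have hd1 : Differentiable ℝ (deriv c) := hc1.differentiable one_ne_zero
  set h : ℝ → ℝ := fun y => c y - (c x + deriv c x * (y - x) + μ / 2 * (y - x) ^ 2) with hh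
  have h1 : ∀ y, HasDerivAt h (deriv c y - deriv c x - μ * (y - x)) y := fun y => by
    have e : HasDerivAt (fun y : ℝ => y - x) 1 y := (hasDerivAt_id y).sub_const x
    have := (hd y).hasDerivAt.sub (((e.const_mul (deriv c x)).const_add (c x)).add
      ((e.pow 2).const_mul (μ / 2)))
    refine this.congr_deriv ?_
    simp; ring
  have hdh : deriv h = fun y => deriv c y - deriv c x - μ * (y - x) := funext fun y => (h1 y).deriv
  have h2 : ∀ y, HasDerivAt (deriv h) (deriv (deriv c) y - μ) y := fun y => by
    rw [hdh]
    have e : HasDerivAt (fun y : ℝ => y - x) 1 y := (hasDerivAt_id y).sub_const x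
    have := ((hd1 y).hasDerivAt.sub_const (deriv c x)).sub (e.const_mul μ)
    exact this.congr_deriv (by simp)
  have hconv : ConvexOn ℝ univ h := convexOn_univ_of_deriv2_nonneg
    (fun y => (h1 y).differentiableAt) (fun y => (h2 y).differentiableAt)
    (fun y => by
      rw [Function.iterate_succ, Function.iterate_one, Function.comp_apply, (h2 y).deriv]
      linarith [hμ y])
  have hmin := hconv.isMinOn_of_rightDeriv_eq_zero (x := x) (by simp) (by
    rw [((h1 x).hasDerivWithinAt).derivWithin (uniqueDiffWithinAt_Ioi x)]
    simp)
  have := hmin (mem_univ y)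
  simp only [mem_ofPred_eq, hh, sub_self] at this
  linarith

/-- The continuous extension to the closed interval. -/
lemma exists_extension {f : ℝ → ℝ} {l : ℝ} (hf : ContinuousOn f (Ioc a b))
    (hl : Tendsto f (𝓝[>] a) (𝓝 l)) :
    ∃ F : ℝ → ℝ, ContinuousOn F (Icc a b) ∧ EqOn F f (Ioc a b) ∧ F a = l := by
  have e : ∀ t, a < t → Function.update f a l t = f t := fun t ht =>
    Function.update_of_ne ht.ne' _ _
  refine ⟨Function.update f a l, ?_, fun t ht => e t ht.1, Function.update_self _ _ _⟩
  intro t ht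
  rcases ht.1.eq_or_lt with rfl | hat
  · have : Tendsto (Function.update f a l) (𝓝[>] a) (𝓝 l) :=
      hl.congr' (by filter_upwards [self_mem_nhdsWithin] with t ht using (e t ht).symm)
    have h2 : ContinuousWithinAt (Function.update f a l) (Ici a) a := by
      rw [← continuousWithinAt_Ioi_iff_Ici, ContinuousWithinAt, Function.update_self]
      exact this
    exact h2.mono Icc_subset_Ici_self
  · have h1 : ContinuousWithinAt f (Icc a b) t := by
      refine (hf t ⟨hat, ht.2⟩).mono_of_mem_nhdsWithin ?_
      filter_upwards [self_mem_nhdsWithin, mem_nhdsWithin_of_mem_nhds (Ioi_mem_nhds hat)]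
        with s hs hs' using ⟨hs', hs.2⟩
    refine h1.congr_of_eventuallyEq ?_ (e t hat)
    filter_upwards [mem_nhdsWithin_of_mem_nhds (Ioi_mem_nhds hat)] with s hs using e s hs

end Analysis

end GridModel

/-! ### Cost of admissible trajectories: continuity and first variation. -/

namespace GridModel

variable {M : ℕ} {P : GridModel M} {t₀ : ℝ} {x₀ z₀ x₁ z₁ : Fin M → ℝ}
  {x z u x' z' u' : ℝ → Fin M → ℝ}

lemma Regular.continuousOn_dℓ (hP : P.Regular) : ContinuousOn P.dℓ (Icc 0 P.T) :=
  hP.ℓ_C1.continuousOn_derivWithin (uniqueDiffOn_Icc hP.T_pos) le_rfl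

lemma Regular.hasDerivWithinAt_ℓ (hP : P.Regular) {t : ℝ} (ht : t ∈ Icc 0 P.T) :
    HasDerivWithinAt P.ℓ (P.dℓ t) (Icc 0 P.T) t :=
  (hP.ℓ_C1.differentiableOn one_ne_zero t ht).hasDerivWithinAt

lemma contDiff_cd : ContDiff ℝ 2 P.cd := contDiff_const.mul (contDiff_id.pow 2)

lemma deriv_cd (v : ℝ) : deriv P.cd v = 2 * P.κ * v := by
  have : HasDerivAt P.cd (P.κ * (2 * v)) v := by
    have := (hasDerivAt_pow 2 v).const_mul P.κ
    simp only [Nat.cast_ofNat, Nat.add_one_sub_one, pow_one] at this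
    exact this
  rw [this.deriv]
  ring

lemma Regular.cd_nonneg (hP : P.Regular) (v : ℝ) : 0 ≤ P.cd v :=
  mul_nonneg hP.κ_pos.le (sq_nonneg v)

lemma Regular.runningCost_nonneg (hP : P.Regular) (a b c : Fin M → ℝ) (t : ℝ) :
    0 ≤ P.runningCost a b c t :=
  add_nonneg (add_nonneg (Finset.sum_nonneg fun i _ => hP.c_nonneg i _) (hP.cg_nonneg _))
    (hP.cd_nonneg _)

lemma continuousOn_cX_comp (hP : P.Regular) {s : Set ℝ} 
    (hx : ∀ i, ContinuousOn (fun t => x t i) s) : ContinuousOn (fun t => P.cX (x t)) s :=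
  continuousOn_finsetSum _ fun i _ => (hP.c_C2 i).continuous.comp_continuousOn (hx i)

lemma totalCost_eq (hP : P.Regular) (ht₀ : t₀ ∈ Icc 0 P.T)
    (hx : ∀ i, ContinuousOn (fun t => x t i) (Icc t₀ P.T))
    (hz : ContinuousOn (fun t => ∑ i, z t i) (Icc t₀ P.T))
    (hu : ContinuousOn (fun t => ∑ i, u t i) (Icc t₀ P.T)) :
    P.totalCost t₀ x z u = ∑ i, (∫ t in t₀..P.T, P.c i (x t i)) +
      (∫ t in t₀..P.T, P.cg (P.ℓ t - ∑ i, z t i)) +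
      ∫ t in t₀..P.T, P.cd ((∑ i, u t i) - P.dℓ t) := by
  have hs : Icc t₀ P.T ⊆ Icc 0 P.T := Icc_subset_Icc_left ht₀.1
  have h1 : ∀ i, IntervalIntegrable (fun t => P.c i (x t i)) volume t₀ P.T := fun i =>
    ((hP.c_C2 i).continuous.comp_continuousOn (hx i)).intervalIntegrable_Icc ht₀.2
  have h2 : IntervalIntegrable (fun t => P.cg (P.ℓ t - ∑ i, z t i)) volume t₀ P.T :=
    (hP.cg_C2.continuous.comp_continuousOn
      ((hP.ℓ_C1.continuousOn.mono hs).sub hz)).intervalIntegrable_Icc ht₀.2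
  have h3 : IntervalIntegrable (fun t => P.cd ((∑ i, u t i) - P.dℓ t)) volume t₀ P.T :=
    (contDiff_cd.continuous.comp_continuousOn
      (hu.sub (hP.continuousOn_dℓ.mono hs))).intervalIntegrable_Icc ht₀.2
  have h1' : IntervalIntegrable (fun t => P.cX (x t)) volume t₀ P.T :=
    (continuousOn_cX_comp hP hx).intervalIntegrable_Icc ht₀.2
  simp only [totalCost, runningCost]
  rw [intervalIntegral.integral_add (h1'.add h2) h3, intervalIntegral.integral_add h1' h2]
  simp only [cX]
  rw [intervalIntegral.integral_finsetSum fun i _ => h1 i]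

namespace IsAdmissible

lemma x_cont (h : P.IsAdmissible t₀ x₀ z₀ x z u) (i : Fin M) :
    ContinuousOn (fun t => x t i) (Icc t₀ P.T) :=
  fun t ht => (h.x_dyn t ht i).continuousWithinAt

lemma z_cont (h : P.IsAdmissible t₀ x₀ z₀ x z u) (i : Fin M) :
    ContinuousOn (fun t => z t i) (Icc t₀ P.T) :=
  fun t ht => (h.z_dyn t ht i).continuousWithinAt

lemma u_cont_apply (h : P.IsAdmissible t₀ x₀ z₀ x z u) (i : Fin M) :
    ContinuousOn (fun t => u t i) (Icc t₀ P.T) :=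
  continuousOn_pi.1 h.u_cont i

lemma z_sum_cont (h : P.IsAdmissible t₀ x₀ z₀ x z u) :
    ContinuousOn (fun t => ∑ i, z t i) (Icc t₀ P.T) :=
  continuousOn_finsetSum _ fun i _ => h.z_cont i

lemma u_sum_cont (h : P.IsAdmissible t₀ x₀ z₀ x z u) :
    ContinuousOn (fun t => ∑ i, u t i) (Icc t₀ P.T) :=
  continuousOn_finsetSum _ fun i _ => h.u_cont_apply i

lemma add_smul (h : P.IsAdmissible t₀ x₀ z₀ x z u) (h' : P.IsAdmissible t₀ x₁ z₁ x' z' u')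
    (ε : ℝ) : P.IsAdmissible t₀ (x₀ + ε • x₁) (z₀ + ε • z₁) (x + ε • x') (z + ε • z')
      (u + ε • u') where
  u_cont := h.u_cont.add (h'.u_cont.const_smul ε)
  x_init := by simp [h.x_init, h'.x_init]
  z_init := by simp [h.z_init, h'.z_init]
  x_dyn t ht i := ((h.x_dyn t ht i).add ((h'.x_dyn t ht i).const_mul ε)).congr_deriv (by
    simp; ring)
  z_dyn t ht i := (h.z_dyn t ht i).add ((h'.z_dyn t ht i).const_mul ε)

lemma add (h : P.IsAdmissible t₀ x₀ z₀ x z u) (h' : P.IsAdmissible t₀ x₁ z₁ x' z' u') :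
    P.IsAdmissible t₀ (x₀ + x₁) (z₀ + z₁) (x + x') (z + z') (u + u') := by
  simpa using h.add_smul h' 1

lemma restrict {t₁ : ℝ} (h : P.IsAdmissible t₀ x₀ z₀ x z u) (h01 : t₀ ≤ t₁) :
    P.IsAdmissible t₁ (x t₁) (z t₁) x z u where
  u_cont := h.u_cont.mono (Icc_subset_Icc_left h01)
  x_init := rfl
  z_init := rfl
  x_dyn t ht i := (h.x_dyn t (Icc_subset_Icc_left h01 ht) i).mono (Icc_subset_Icc_left h01)
  z_dyn t ht i := (h.z_dyn t (Icc_subset_Icc_left h01 ht) i).mono (Icc_subset_Icc_left h01)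

lemma continuousOn_runningCost (hP : P.Regular) (ht₀ : 0 ≤ t₀)
    (h : P.IsAdmissible t₀ x₀ z₀ x z u) :
    ContinuousOn (fun t => P.runningCost (x t) (z t) (u t) t) (Icc t₀ P.T) := by
  have hs : Icc t₀ P.T ⊆ Icc 0 P.T := Icc_subset_Icc_left ht₀
  exact ((continuousOn_cX_comp hP h.x_cont).add (hP.cg_C2.continuous.comp_continuousOn
      ((hP.ℓ_C1.continuousOn.mono hs).sub h.z_sum_cont))).add
    (contDiff_cd.continuous.comp_continuousOn (h.u_sum_cont.sub (hP.continuousOn_dℓ.mono hs)))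

/-- The cost is continuous under bounded pointwise convergence of the states and of the sums. -/
lemma tendsto_totalCost (hP : P.Regular) (ht₀ : t₀ ∈ Icc 0 P.T)
    (h : P.IsAdmissible t₀ x₀ z₀ x z u) {δx δz δu : ℕ → ℝ → Fin M → ℝ}
    (hx : ∀ i, IsVanishing t₀ P.T fun n t => δx n t i)
    (hz : IsVanishing t₀ P.T fun n t => ∑ i, δz n t i)
    (hu : IsVanishing t₀ P.T fun n t => ∑ i, δu n t i) :
    Tendsto (fun n => P.totalCost t₀ (x + δx n) (z + δz n) (u + δu n)) atTop
      (𝓝 (P.totalCost t₀ x z u)) := by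
  have hs : Icc t₀ P.T ⊆ Icc 0 P.T := Icc_subset_Icc_left ht₀.1
  rw [totalCost_eq hP ht₀ h.x_cont h.z_sum_cont h.u_sum_cont]
  have e : ∀ n, P.totalCost t₀ (x + δx n) (z + δz n) (u + δu n) =
      ∑ i, (∫ t in t₀..P.T, P.c i (x t i + δx n t i)) +
      (∫ t in t₀..P.T, P.cg ((P.ℓ t - ∑ i, z t i) + (-1) * ∑ i, δz n t i)) +
      ∫ t in t₀..P.T, P.cd (((∑ i, u t i) - P.dℓ t) + ∑ i, δu n t i) := fun n => by
    rw [totalCost_eq (x := x + δx n) hP ht₀ (fun i => (h.x_cont i).add ((hx i).cont n))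
      (by simpa [Finset.sum_add_distrib] using h.z_sum_cont.fun_add (hz.cont n))
      (by simpa [Finset.sum_add_distrib] using h.u_sum_cont.fun_add (hu.cont n))]
    simp only [Pi.add_apply, Finset.sum_add_distrib]
    congr 2
    · refine intervalIntegral.integral_congr fun t _ => ?_
      ring_nf
    · funext t
      congr 1; ring
  simp only [e]
  refine ((tendsto_finsetSum _ fun i _ => tendsto_integral_comp_add (hP.c_C2 i).continuous ht₀.2
    (h.x_cont i) (hx i)).add ?_).add ?_
  · exact tendsto_integral_comp_add hP.cg_C2.continuous ht₀.2
      ((hP.ℓ_C1.continuousOn.mono hs).sub h.z_sum_cont) (hz.const_mul (-1))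
  · exact tendsto_integral_comp_add contDiff_cd.continuous ht₀.2
      (h.u_sum_cont.sub (hP.continuousOn_dℓ.mono hs)) hu

/-- First variation of the cost. -/
lemma hasDerivAt_totalCost (hP : P.Regular) (ht₀ : t₀ ∈ Icc 0 P.T)
    (h : P.IsAdmissible t₀ x₀ z₀ x z u) (h' : P.IsAdmissible t₀ x₁ z₁ x' z' u') :
    HasDerivAt (fun ε : ℝ => P.totalCost t₀ (x + ε • x') (z + ε • z') (u + ε • u'))
      (∑ i, (∫ t in t₀..P.T, deriv (P.c i) (x t i) * x' t i) -
        (∫ t in t₀..P.T, deriv P.cg (P.ℓ t - ∑ i, z t i) * ∑ i, z' t i) +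
        ∫ t in t₀..P.T, 2 * P.κ * ((∑ i, u t i) - P.dℓ t) * ∑ i, u' t i) 0 := by
  have hs : Icc t₀ P.T ⊆ Icc 0 P.T := Icc_subset_Icc_left ht₀.1
  have e : ∀ ε : ℝ, P.totalCost t₀ (x + ε • x') (z + ε • z') (u + ε • u') =
      ∑ i, (∫ t in t₀..P.T, P.c i (x t i + ε * x' t i)) +
      (∫ t in t₀..P.T, P.cg ((P.ℓ t - ∑ i, z t i) + ε * (-∑ i, z' t i))) +
      ∫ t in t₀..P.T, P.cd (((∑ i, u t i) - P.dℓ t) + ε * ∑ i, u' t i) := fun ε => by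
    have ha := h.add_smul h' ε
    rw [totalCost_eq hP ht₀ ha.x_cont ha.z_sum_cont ha.u_sum_cont]
    simp only [Pi.add_apply, Pi.smul_apply, smul_eq_mul, Finset.sum_add_distrib,
      ← Finset.mul_sum]
    congr 2
    · refine intervalIntegral.integral_congr fun t _ => ?_
      ring_nf
    · funext t
      congr 1; ring
  simp only [e]
  have h1 := HasDerivAt.fun_sum fun i (_ : i ∈ Finset.univ) => hasDerivAt_integral_comp
    ((hP.c_C2 i).of_le one_le_two) ht₀.2 (h.x_cont i) (h'.x_cont i)
  have h2 := hasDerivAt_integral_comp (hP.cg_C2.of_le one_le_two) ht₀.2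
    ((hP.ℓ_C1.continuousOn.mono hs).sub h.z_sum_cont) h'.z_sum_cont.neg
  have h3 := hasDerivAt_integral_comp (contDiff_cd (P := P).of_le one_le_two) ht₀.2
    (h.u_sum_cont.sub (hP.continuousOn_dℓ.mono hs)) h'.u_sum_cont
  refine ((h1.add h2).add h3).congr_deriv ?_
  simp only [deriv_cd, Pi.sub_apply, Pi.neg_apply, mul_neg, intervalIntegral.integral_neg,
    sub_eq_add_neg]

end IsAdmissible

lemma exists_isAdmissible (x₀ z₀ : Fin M → ℝ) {u : ℝ → Fin M → ℝ} 
    (hu : ContinuousOn u (Icc t₀ P.T)) : ∃ x z, P.IsAdmissible t₀ x₀ z₀ x z u := by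
  have hz : ∀ i, ∀ t ∈ Icc t₀ P.T, HasDerivWithinAt (fun t => z₀ i + ∫ s in t₀..t, u s i) (u t i)
      (Icc t₀ P.T) t := fun i t ht =>
    (hasDerivWithinAt_integral (continuousOn_pi.1 hu i) ht).const_add _
  have hf : ∀ i, ContinuousOn (fun t => -(z₀ i + ∫ s in t₀..t, u s i) - P.α i * x₀ i)
      (Icc t₀ P.T) := fun i =>
    (ContinuousOn.neg fun t ht => (hz i t ht).continuousWithinAt).sub continuousOn_const
  refine ⟨fun t i => x₀ i + linSol (P.α i)
    (fun t => -(z₀ i + ∫ s in t₀..t, u s i) - P.α i * x₀ i) t₀ t,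
    fun t i => z₀ i + ∫ s in t₀..t, u s i, hu, ?_, ?_, fun t ht i => ?_, fun t ht i => hz i t ht⟩
  · simp [linSol_left]
  · simp
  · exact ((hasDerivWithinAt_linSol (P.α i) (hf i) ht).const_add (x₀ i)).congr_deriv (by ring)

lemma totalCost_nonneg (hP : P.Regular) (ht₀ : t₀ ≤ P.T) : 0 ≤ P.totalCost t₀ x z u :=
  intervalIntegral.integral_nonneg ht₀ fun _ _ => hP.runningCost_nonneg _ _ _ _

lemma bddBelow_J (hP : P.Regular) (ht₀ : t₀ ≤ P.T) :
    BddBelow {v | ∃ x z u, P.IsAdmissible t₀ x₀ z₀ x z u ∧ v = P.totalCost t₀ x z u} :=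
  ⟨0, by rintro _ ⟨x, z, u, -, rfl⟩; exact totalCost_nonneg hP ht₀⟩

lemma nonempty_J :
    {v | ∃ x z u, P.IsAdmissible t₀ x₀ z₀ x z u ∧ v = P.totalCost t₀ x z u}.Nonempty := by
  obtain ⟨x, z, h⟩ := exists_isAdmissible (P := P) (t₀ := t₀) x₀ z₀ (u := 0) continuousOn_const
  exact ⟨_, x, z, 0, h, rfl⟩

lemma IsAdmissible.J_le (hP : P.Regular) (ht₀ : t₀ ≤ P.T) (h : P.IsAdmissible t₀ x₀ z₀ x z u) :
    P.J x₀ z₀ t₀ ≤ P.totalCost t₀ x z u :=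
  csInf_le (bddBelow_J hP ht₀) ⟨x, z, u, h, rfl⟩

end GridModel

/-! ### Initial layers: dependence on the sums only, and dynamic programming. -/

namespace GridModel

section Jets

/-- A path with value `d` and slope `e` at time `a` that decays fast for large `n`. -/
noncomputable def jet (a d e n t : ℝ) : ℝ :=
  ((1 + n * (t - a)) * d + (t - a) * e) * Real.exp (-(n * (t - a)))

/-- The derivative of `jet`. -/
noncomputable def jetDeriv (a d e n t : ℝ) : ℝ :=
  ((1 - n * (t - a)) * e - n ^ 2 * (t - a) * d) * Real.exp (-(n * (t - a)))

/-- The second derivative of `jet`. -/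
noncomputable def jetDeriv2 (a d e n t : ℝ) : ℝ :=
  ((n ^ 2 * (t - a) - 2 * n) * e + (n ^ 3 * (t - a) - n ^ 2) * d) * Real.exp (-(n * (t - a)))

/-- A path that vanishes to first order at time `a` and has second derivative `w` there. -/
noncomputable def bend (a w n t : ℝ) : ℝ :=
  (w / 2 * (t - a) ^ 2) * Real.exp (-(n * (t - a)))

/-- The derivative of `bend`. -/
noncomputable def bendDeriv (a w n t : ℝ) : ℝ :=
  (w * ((t - a) - n * (t - a) ^ 2 / 2)) * Real.exp (-(n * (t - a)))

/-- The second derivative of `bend`. -/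
noncomputable def bendDeriv2 (a w n t : ℝ) : ℝ :=
  (w * (1 - 2 * (n * (t - a)) + (n * (t - a)) ^ 2 / 2)) * Real.exp (-(n * (t - a)))

variable (a d e w n t : ℝ)

lemma hasDerivAt_mul_exp_neg {p : ℝ → ℝ} {p' : ℝ} (hp : HasDerivAt p p' t) :
    HasDerivAt (fun t => p t * Real.exp (-(n * (t - a))))
      ((p' - n * p t) * Real.exp (-(n * (t - a)))) t := by
  have h1 : HasDerivAt (fun t => Real.exp (-(n * (t - a)))) (Real.exp (-(n * (t - a))) * (-n)) t := by
    have := ((((hasDerivAt_id t).sub_const a).const_mul n).neg).exp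
    simpa using this
  exact (hp.mul h1).congr_deriv (by ring)

lemma hasDerivAt_jet : HasDerivAt (jet a d e n) (jetDeriv a d e n t) t := by
  have h : HasDerivAt (fun t : ℝ => t - a) 1 t := (hasDerivAt_id t).sub_const a
  refine (hasDerivAt_mul_exp_neg a n t ((((h.const_mul n).const_add 1).mul_const d).add
    (h.mul_const e))).congr_deriv ?_
  simp only [jetDeriv, Pi.add_apply]
  ring

lemma hasDerivAt_jetDeriv : HasDerivAt (jetDeriv a d e n) (jetDeriv2 a d e n t) t := by
  have h : HasDerivAt (fun t : ℝ => t - a) 1 t := (hasDerivAt_id t).sub_const a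
  refine (hasDerivAt_mul_exp_neg a n t ((((h.const_mul n).const_sub 1).mul_const e).sub
    ((h.const_mul (n ^ 2)).mul_const d))).congr_deriv ?_
  simp only [jetDeriv2, Pi.sub_apply]
  ring

lemma hasDerivAt_bend : HasDerivAt (bend a w n) (bendDeriv a w n t) t := by
  have h : HasDerivAt (fun t : ℝ => t - a) 1 t := (hasDerivAt_id t).sub_const a
  refine (hasDerivAt_mul_exp_neg a n t ((h.pow 2).const_mul (w / 2))).congr_deriv ?_
  simp only [bendDeriv, Pi.pow_apply]
  ring

lemma hasDerivAt_bendDeriv : HasDerivAt (bendDeriv a w n) (bendDeriv2 a w n t) t := by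
  have h : HasDerivAt (fun t : ℝ => t - a) 1 t := (hasDerivAt_id t).sub_const a
  refine (hasDerivAt_mul_exp_neg a n t
    ((h.sub (((h.pow 2).const_mul n).div_const 2)).const_mul w)).congr_deriv ?_
  simp only [bendDeriv2, Pi.pow_apply, Pi.sub_apply]
  ring

lemma continuous_jetDeriv2 : Continuous (jetDeriv2 a d e n) := by
  unfold jetDeriv2
  fun_prop

lemma continuous_bendDeriv2 : Continuous (bendDeriv2 a w n) := by
  unfold bendDeriv2
  fun_prop

variable (b : ℝ)

/-- Only the path itself vanishes. Its derivative has size about `n d`, so it is harmless only where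
the cost does not see it. -/
lemma isVanishing_jet : IsVanishing a b fun n t => jet a d e n t := by
  convert ((IsVanishing.pow_mul_exp (a := a) (b := b) 0).mul
    (h := fun t => d + (t - a) * e) (by fun_prop)).add
      ((IsVanishing.pow_mul_exp (a := a) (b := b) 1).const_mul d) using 3
  simp only [jet]
  ring

lemma isVanishing_bend : IsVanishing a b fun n t => bend a w n t := by
  convert (IsVanishing.pow_mul_exp (a := a) (b := b) 0).mul
    (h := fun t => w / 2 * (t - a) ^ 2) (by fun_prop) using 3
  simp only [bend]
  ring

lemma isVanishing_bendDeriv : IsVanishing a b fun n t => bendDeriv a w n t := by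
  convert ((IsVanishing.pow_mul_exp (a := a) (b := b) 0).mul
    (h := fun t => w * (t - a)) (by fun_prop)).add
      ((IsVanishing.pow_mul_exp (a := a) (b := b) 1).mul
        (h := fun t => -(w * (t - a) / 2)) (by fun_prop)) using 3
  simp only [bendDeriv]
  ring

/-- The value at `t = a` is `w` for all `n`, yet the functions are bounded and tend to zero
elsewhere: an input can be changed at one instant at no cost in the limit. -/
lemma isVanishing_bendDeriv2 : IsVanishing a b fun n t => bendDeriv2 a w n t := by
  convert ((IsVanishing.pow_mul_exp (a := a) (b := b) 0).const_mul w).add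
      (((IsVanishing.pow_mul_exp (a := a) (b := b) 1).const_mul (-2 * w)).add
      ((IsVanishing.pow_mul_exp (a := a) (b := b) 2).const_mul (w / 2))) using 3
  simp only [bendDeriv2]
  ring

end Jets

variable {M : ℕ} {P : GridModel M} {t₀ : ℝ} {x₀ z₀ x₁ z₁ : Fin M → ℝ}
  {x z u x' z' u' : ℝ → Fin M → ℝ}

/-- The trajectory with given twice differentiable states of charge. -/
lemma isAdmissible_of_hasDerivAt {y y' y'' : Fin M → ℝ → ℝ}
    (h : ∀ i t, HasDerivAt (y i) (y' i t) t) (h' : ∀ i t, HasDerivAt (y' i) (y'' i t) t)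
    (hc : ∀ i, Continuous (y'' i)) :
    P.IsAdmissible t₀ (fun i => y i t₀) (fun i => -y' i t₀ - P.α i * y i t₀) (fun t i => y i t)
      (fun t i => -y' i t - P.α i * y i t) (fun t i => -y'' i t - P.α i * y' i t) where
  u_cont := by
    have : ∀ i, Continuous (y' i) := fun i =>
      continuous_iff_continuousAt.2 fun t => (h' i t).continuousAt
    fun_prop
  x_init := rfl
  z_init := rfl
  x_dyn t _ i := (h i t).hasDerivWithinAt.congr_deriv (by ring)
  z_dyn t _ i := ((h' i t).neg.sub ((h i t).const_mul _)).hasDerivWithinAt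

/-- The infimal cost depends on the initial state only through the sums of its components. -/
lemma J_le_totalCost_of_sum_eq (hM : 0 < M) (hP : P.Regular) (ht₀ : t₀ ∈ Icc 0 P.T)
    (h : P.IsAdmissible t₀ x₁ z₁ x z u) (hx : ∑ i, x₀ i = ∑ i, x₁ i)
    (hz : ∑ i, z₀ i = ∑ i, z₁ i) : P.J x₀ z₀ t₀ ≤ P.totalCost t₀ x z u := by
  let k : Fin M := ⟨0, hM⟩
  let d : Fin M → ℝ := fun i => x₀ i - x₁ i
  -- As `z = -x' - α x`, this slope makes the layer start at `z₀ - z₁`.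
  let e : Fin M → ℝ := fun i => -(z₀ i - z₁ i) - P.α i * d i
  let y : ℕ → Fin M → ℝ → ℝ := fun n i => jet t₀ (d i) (e i) n
  let y' : ℕ → Fin M → ℝ → ℝ := fun n i => jetDeriv t₀ (d i) (e i) n
  let y'' : ℕ → Fin M → ℝ → ℝ := fun n i => jetDeriv2 t₀ (d i) (e i) n
  let Z : ℕ → ℝ → Fin M → ℝ := fun n t i => -y' n i t - P.α i * y n i t
  let U : ℕ → ℝ → Fin M → ℝ := fun n t i => -y'' n i t - P.α i * y' n i t
  let f : ℕ → ℝ → ℝ := fun n t => ∑ i, (P.α k - P.α i) * y n i t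
  -- Load `k` gets the extra state `q` belonging to `z = -∑ i, Z n t i`. Then `p = q + ∑ i, y n i`
  -- solves `p' = -α_k p + f`, in which the derivatives of the layers have cancelled; and `p(t₀) =
  -- 0` because the `d i` sum to zero.
  let q : ℕ → ℝ → ℝ := fun n t => linSol (P.α k) (f n) t₀ t + (-1) * ∑ i, y n i t
  have hy : ∀ i, IsVanishing t₀ P.T fun n t => y n i t := fun i => isVanishing_jet _ _ _ _
  have hf : IsVanishing t₀ P.T f := IsVanishing.sum _ fun i => (hy i).const_mul _
  have hq : IsVanishing t₀ P.T q := (hf.linSol _).add ((IsVanishing.sum _ hy).const_mul _)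
  have hd : ∑ i, d i = 0 := by simp [d, hx]
  have hy0 : ∀ n i, y n i t₀ = d i := fun n i => by simp [y, jet]
  have hy0' : ∀ n i, y' n i t₀ = e i := fun n i => by simp [y', jetDeriv]
  have hZ0 : ∀ n, Z n t₀ = fun i => z₀ i - z₁ i := fun n => by
    funext i
    simp only [Z, hy0, hy0', e]
    ring
  have h1 : ∀ n, P.IsAdmissible t₀ (fun i => x₀ i - x₁ i) (fun i => z₀ i - z₁ i)
      (fun t i => y n i t) (Z n) (U n) := fun n => by
    have := isAdmissible_of_hasDerivAt (P := P) (t₀ := t₀) (y := y n) (y' := y' n) (y'' := y'' n)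
      (fun i t => hasDerivAt_jet _ _ _ _ t) (fun i t => hasDerivAt_jetDeriv _ _ _ _ t)
      (fun i => continuous_jetDeriv2 _ _ _ _)
    rw [← hZ0 n]
    simp only [hy0] at this ⊢
    convert this using 2
    simp only [Z, hy0]
  have h2 : ∀ n, P.IsAdmissible t₀ 0 0 (fun t => Pi.single k (q n t))
      (fun t => Pi.single k (-∑ i, Z n t i)) (fun t => Pi.single k (-∑ i, U n t i)) := fun n =>
    { u_cont := by
        refine continuousOn_pi.2 fun i => ?_
        rcases eq_or_ne i k with rfl | hi
        · simpa using (h1 n).u_sum_cont.fun_neg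
        · simpa [hi] using continuousOn_const
      x_init := by simp [q, linSol_left, hy0, hd]
      z_init := by simp [hZ0, hz]
      x_dyn := fun t ht i => by
        rcases eq_or_ne i k with rfl | hi
        · simp only [Pi.single_eq_same]
          have hs : HasDerivAt (fun t => ∑ i, y n i t) (∑ i, y' n i t) t :=
            HasDerivAt.fun_sum fun i _ => hasDerivAt_jet _ _ _ _ t
          refine ((hasDerivWithinAt_linSol _ (hf.cont n) ht).add
            (hs.const_mul (-1)).hasDerivWithinAt).congr_deriv ?_
          simp only [q, Z, f, Finset.sum_sub_distrib, Finset.sum_neg_distrib, sub_mul,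
            ← Finset.mul_sum]
          ring
        · simpa [hi] using hasDerivWithinAt_const t _ (0 : ℝ)
      z_dyn := fun t ht i => by
        rcases eq_or_ne i k with rfl | hi
        · simp only [Pi.single_eq_same]
          exact (HasDerivWithinAt.fun_sum fun i _ => (h1 n).z_dyn t ht i).neg
        · simpa [hi] using hasDerivWithinAt_const t _ (0 : ℝ) }
  have hadm := fun n => h.add ((h1 n).add (h2 n))
  have hlim := h.tendsto_totalCost hP ht₀
    (δx := fun n => (fun t i => y n i t) + fun t => Pi.single k (q n t))
    (δz := fun n => Z n + fun t => Pi.single k (-∑ i, Z n t i))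
    (δu := fun n => U n + fun t => Pi.single k (-∑ i, U n t i))
    (fun i => by
      rcases eq_or_ne i k with rfl | hi
      · simpa using (hy _).add hq
      · simpa [hi] using hy i)
    -- The perturbations of `z_σ` and `u_σ` are identically zero; the large individual layers never
    -- enter the cost.
    (by simpa [Finset.sum_add_distrib] using IsVanishing.zero)
    (by simpa [Finset.sum_add_distrib] using IsVanishing.zero)
  refine ge_of_tendsto' hlim fun n => ?_
  have hx0 : x₁ + ((fun i => x₀ i - x₁ i) + 0) = x₀ := by funext i; simp
  have hz0 : z₁ + ((fun i => z₀ i - z₁ i) + 0) = z₀ := by funext i; simp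
  have := (hadm n).J_le hP ht₀.2
  rwa [hx0, hz0] at this

lemma J_congr (hM : 0 < M) (hP : P.Regular) (ht₀ : t₀ ∈ Icc 0 P.T)
    (hx : ∑ i, x₀ i = ∑ i, x₁ i) (hz : ∑ i, z₀ i = ∑ i, z₁ i) : P.J x₀ z₀ t₀ = P.J x₁ z₁ t₀ := by
  refine le_antisymm (le_csInf nonempty_J ?_) (le_csInf nonempty_J ?_)
  · rintro _ ⟨x, z, u, h, rfl⟩
    exact J_le_totalCost_of_sum_eq hM hP ht₀ h hx hz
  · rintro _ ⟨x, z, u, h, rfl⟩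
    exact J_le_totalCost_of_sum_eq hM hP ht₀ h hx.symm hz.symm

lemma K_eq_J (hM : 0 < M) (hP : P.Regular) (ht₀ : t₀ ∈ Icc 0 P.T) (x₀ z₀ : Fin M → ℝ) :
    P.K (∑ i, x₀ i) (∑ i, z₀ i) t₀ = P.J x₀ z₀ t₀ := by
  have : {v | ∃ x z : Fin M → ℝ, ∑ i, x i = ∑ i, x₀ i ∧ ∑ i, z i = ∑ i, z₀ i ∧
      v = P.J x z t₀} = {P.J x₀ z₀ t₀} := by
    refine Subset.antisymm ?_ ?_
    · rintro _ ⟨x, z, hx, hz, rfl⟩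
      exact J_congr hM hP ht₀ hx hz
    · rintro _ rfl
      exact ⟨x₀, z₀, rfl, rfl, rfl⟩
  rw [K, this, csInf_singleton]

/-- The initial value of the input can be prescribed at arbitrarily small extra cost. -/
lemma IsAdmissible.exists_input_eq (hP : P.Regular) (ht₀ : t₀ ∈ Icc 0 P.T)
    (h : P.IsAdmissible t₀ x₀ z₀ x z u) (w : Fin M → ℝ) {r : ℝ}
    (hr : P.totalCost t₀ x z u < r) :
    ∃ x' z' u', P.IsAdmissible t₀ x₀ z₀ x' z' u' ∧ u' t₀ = w ∧ P.totalCost t₀ x' z' u' < r := by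
  -- At `t₀` the input of the bend is `-v`, which turns `u t₀` into `w`.
  let v : Fin M → ℝ := fun i => u t₀ i - w i
  have h1 : ∀ n : ℕ, P.IsAdmissible t₀ 0 0 (fun t i => bend t₀ (v i) n t)
      (fun t i => -bendDeriv t₀ (v i) n t - P.α i * bend t₀ (v i) n t)
      (fun t i => -bendDeriv2 t₀ (v i) n t - P.α i * bendDeriv t₀ (v i) n t) := fun n => by
    convert isAdmissible_of_hasDerivAt (P := P) (t₀ := t₀) (y := fun i => bend t₀ (v i) n)
      (fun i t => hasDerivAt_bend _ _ _ t) (fun i t => hasDerivAt_bendDeriv _ _ _ t)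
      (fun i => continuous_bendDeriv2 _ _ _) using 1
    · funext i; simp [bend]
    · funext i; simp [bend, bendDeriv]
  have hlim := h.tendsto_totalCost hP ht₀ (δx := fun n t i => bend t₀ (v i) n t)
    (δz := fun n t i => -bendDeriv t₀ (v i) n t - P.α i * bend t₀ (v i) n t)
    (δu := fun n t i => -bendDeriv2 t₀ (v i) n t - P.α i * bendDeriv t₀ (v i) n t)
    (fun i => isVanishing_bend _ _ _)
    (IsVanishing.sum _ fun i => by
      convert ((isVanishing_bendDeriv t₀ (v i) P.T).const_mul (-1)).add
        ((isVanishing_bend t₀ (v i) P.T).const_mul (-P.α i)) using 3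
      ring)
    (IsVanishing.sum _ fun i => by
      convert ((isVanishing_bendDeriv2 t₀ (v i) P.T).const_mul (-1)).add
        ((isVanishing_bendDeriv t₀ (v i) P.T).const_mul (-P.α i)) using 3
      ring)
  obtain ⟨n, hn⟩ := (hlim.eventually_lt_const hr).exists
  refine ⟨_, _, _, by simpa using h.add (h1 n), ?_, hn⟩
  funext i
  simp [bendDeriv, bendDeriv2, v]

/-- Concatenation of trajectories whose states and inputs match at time `t₁`. -/
lemma IsAdmissible.concat {t₁ : ℝ} (h01 : t₀ ≤ t₁) (h1T : t₁ ≤ P.T)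
    (h : P.IsAdmissible t₀ x₀ z₀ x z u) (h' : P.IsAdmissible t₁ (x t₁) (z t₁) x' z' u')
    (hu : u' t₁ = u t₁) :
    P.IsAdmissible t₀ x₀ z₀ (fun t i => if t ≤ t₁ then x t i else x' t i)
      (fun t i => if t ≤ t₁ then z t i else z' t i)
      (fun t i => if t ≤ t₁ then u t i else u' t i) where
  u_cont := continuousOn_pi.2 fun i => continuousOn_glue h01 h1T
    ((h.u_cont_apply i).mono (Icc_subset_Icc_right h1T)) (h'.u_cont_apply i) (by rw [hu])
  x_init := by simp [h01, h.x_init]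
  z_init := by simp [h01, h.z_init]
  x_dyn t ht i := by
    refine (hasDerivWithinAt_glue h01 h1T
      (fun t ht => (h.x_dyn t (Icc_subset_Icc_right h1T ht) i).mono (Icc_subset_Icc_right h1T))
      (fun t ht => h'.x_dyn t ht i) (by rw [h'.x_init]) (by rw [h'.x_init, h'.z_init])
      ht).congr_deriv ?_
    split_ifs <;> rfl
  z_dyn t ht i := hasDerivWithinAt_glue h01 h1T
      (fun t ht => (h.z_dyn t (Icc_subset_Icc_right h1T ht) i).mono (Icc_subset_Icc_right h1T))
      (fun t ht => h'.z_dyn t ht i) (by rw [h'.z_init]) (by rw [hu]) ht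

/-- The easy half of the dynamic programming principle. -/
lemma IsAdmissible.J_le_integral_add_J (hP : P.Regular) {t₁ : ℝ} (h0 : 0 ≤ t₀) (h01 : t₀ ≤ t₁)
    (h1T : t₁ ≤ P.T) (h : P.IsAdmissible t₀ x₀ z₀ x z u) :
    P.J x₀ z₀ t₀ ≤ (∫ t in t₀..t₁, P.runningCost (x t) (z t) (u t) t) + P.J (x t₁) (z t₁) t₁ := by
  rw [← sub_le_iff_le_add']
  refine le_csInf nonempty_J ?_
  rintro _ ⟨y, w, v, hy, rfl⟩
  refine le_of_forall_gt_imp_ge_of_dense fun r hr => ?_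
  -- Admissible inputs are continuous, so the tail must first be replaced by one whose input matches
  -- at `t₁`; the slack up to `r` pays for this.
  obtain ⟨y', w', v', hy', hv', hr'⟩ := hy.exists_input_eq hP ⟨h0.trans h01, h1T⟩ (u t₁) hr
  have hc := h.concat h01 h1T hy' hv'
  have hle := hc.J_le hP (h01.trans h1T)
  have hi := hc.continuousOn_runningCost hP h0
  rw [totalCost, ← intervalIntegral.integral_add_adjacent_intervals
    ((hi.mono (Icc_subset_Icc_right h1T)).intervalIntegrable_Icc h01)
    ((hi.mono (Icc_subset_Icc_left h01)).intervalIntegrable_Icc h1T)] at hle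
  have e1 := integral_congr_Ioc h01 (f := fun t => P.runningCost
      (fun i => if t ≤ t₁ then x t i else y' t i) (fun i => if t ≤ t₁ then z t i else w' t i)
      (fun i => if t ≤ t₁ then u t i else v' t i) t)
    (g := fun t => P.runningCost (x t) (z t) (u t) t) fun t ht => by simp [ht.2]
  have e2 := integral_congr_Ioc h1T (f := fun t => P.runningCost
      (fun i => if t ≤ t₁ then x t i else y' t i) (fun i => if t ≤ t₁ then z t i else w' t i)
      (fun i => if t ≤ t₁ then u t i else v' t i) t)
    (g := fun t => P.runningCost (y' t) (w' t) (v' t) t) fun t ht => by simp [ht.1.not_ge]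
  rw [e1, e2] at hle
  rw [totalCost] at hr'
  linarith

end GridModel

/-! ### The optimal solution: value along the trajectory, common costate, Euler-Lagrange equation.
-/

namespace GridModel

variable {M : ℕ} {P : GridModel M} {x₀ z₀ : Fin M → ℝ} {x z u : ℝ → Fin M → ℝ}

namespace IsOptimal

lemma u_cont (h : P.IsOptimal 0 x₀ z₀ x z u) : ContinuousOn u (Ioc 0 P.T) := by
  refine continuousOn_pi.2 fun i => ?_
  have h1 : ContDiffOn ℝ 1 (fun t => z t i) (Ioc 0 P.T) := contDiffOn_pi.1 h.z_C1 i
  refine (h1.continuousOn_derivWithin (uniqueDiffOn_Ioc 0 P.T) le_rfl).congr fun t ht => ?_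
  exact ((h.z_dyn t ht i).derivWithin (uniqueDiffOn_Ioc 0 P.T t ht)).symm

/-- After the jump at time `0` an optimal solution is an ordinary trajectory from its current state.
-/
lemma isAdmissible (h : P.IsOptimal 0 x₀ z₀ x z u) {t : ℝ} (ht : 0 < t) :
    P.IsAdmissible t (x t) (z t) x z u := by
  have hs : Icc t P.T ⊆ Ioc 0 P.T := fun s hs => ⟨ht.trans_le hs.1, hs.2⟩
  exact ⟨h.u_cont.mono hs, rfl, rfl, fun s hst i => (h.x_dyn s (hs hst) i).mono hs,
    fun s hst i => (h.z_dyn s (hs hst) i).mono hs⟩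

/-- The tail of an optimal solution attains the value function of the aggregate state. -/
lemma K_eq_totalCost (hM : 0 < M) (hP : P.Regular) (hK : P.ValueC1)
    (h : P.IsOptimal 0 x₀ z₀ x z u) {t : ℝ} (ht : t ∈ Ioc 0 P.T) :
    P.K (∑ i, x t i) (∑ i, z t i) t = P.totalCost t x z u := by
  have hmem : ∀ {s}, s ∈ Ioc 0 P.T → s ∈ Icc 0 P.T := fun hs => Ioc_subset_Icc_self hs
  rw [K_eq_J hM hP (hmem ht)]
  refine le_antisymm ((h.isAdmissible ht.1).J_le hP ht.2) ?_
  obtain ⟨a, ha, hax⟩ := h.x_lim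
  obtain ⟨b, hb, hbz⟩ := h.z_lim
  set f : ℝ → ℝ := fun t => P.runningCost (x t) (z t) (u t) t with hf
  have hsub : ∀ {s r}, s ∈ Icc 0 P.T → r ∈ Icc 0 P.T → IntervalIntegrable f volume s r :=
    fun {s r} hs hr => h.cost_integrable.mono_set (by
      rw [uIcc_of_le hP.T_pos.le]; exact uIcc_subset_Icc hs hr)
  have h0 : (0 : ℝ) ∈ Icc 0 P.T := left_mem_Icc.2 hP.T_pos.le
  have hnear : ∀ᶠ s in 𝓝[>] (0 : ℝ), s ∈ Ioc 0 t := Ioc_mem_nhdsGT ht.1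
  have hKlim : Tendsto (fun s => P.K (∑ i, x s i) (∑ i, z s i) s) (𝓝[>] 0)
      (𝓝 (P.K (∑ i, x₀ i) (∑ i, z₀ i) 0)) := by
    have hc := hK.continuousOn (∑ i, x₀ i, ∑ i, z₀ i, (0 : ℝ)) h0
    refine hc.tendsto.comp (f := fun s => (∑ i, x s i, ∑ i, z s i, s))
      (tendsto_nhdsWithin_iff.2 ⟨?_, ?_⟩)
    · refine Tendsto.prodMk_nhds ?_ (Tendsto.prodMk_nhds ?_ ?_)
      · rw [← hax]
        exact tendsto_finsetSum _ fun i _ => (continuous_apply i).tendsto _ |>.comp ha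
      · rw [← hbz]
        exact tendsto_finsetSum _ fun i _ => (continuous_apply i).tendsto _ |>.comp hb
      · exact tendsto_nhdsWithin_of_tendsto_nhds tendsto_id
    · filter_upwards [hnear] with s hs using ⟨hs.1.le, hs.2.trans ht.2⟩
  have hIlim : Tendsto (fun s => ∫ τ in s..t, f τ) (𝓝[>] 0) (𝓝 (∫ τ in (0 : ℝ)..t, f τ)) := by
    have hc := intervalIntegral.continuousOn_primitive_interval_left (f := f) (μ := volume)
      (a := 0) (b := t) (by
        have := (hsub h0 (hmem ht)).1
        rwa [uIcc_of_le ht.1.le, integrableOn_Icc_iff_integrableOn_Ioc])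
    have := hc 0 left_mem_uIcc
    refine this.tendsto.mono_left ?_
    rw [uIcc_of_le ht.1.le, ← nhdsWithin_Ioc_eq_nhdsGT ht.1]
    exact nhdsWithin_mono _ Ioc_subset_Icc_self
  -- Dynamic programming from `s > 0`, then `s → 0`. The jump does no harm: `K` sees only the sums,
  -- and these converge to the given initial sums.
  have hle : P.K (∑ i, x₀ i) (∑ i, z₀ i) 0 ≤ (∫ τ in (0 : ℝ)..t, f τ) + P.J (x t) (z t) t := by
    refine le_of_tendsto_of_tendsto hKlim (hIlim.add_const _) ?_
    filter_upwards [hnear] with s hs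
    rw [K_eq_J hM hP ⟨hs.1.le, hs.2.trans ht.2⟩]
    exact (h.isAdmissible hs.1).J_le_integral_add_J hP hs.1.le hs.2 ht.2
  rw [K_eq_J hM hP h0, ← h.cost_eq, totalCost,
    ← intervalIntegral.integral_add_adjacent_intervals (hsub h0 (hmem ht))
      (hsub (hmem ht) (right_mem_Icc.2 hP.T_pos.le))] at hle
  rw [totalCost]
  linarith

/-- The whole line in direction `r` stays in the domain, so the derivative is two-sided even at the
end times. -/
lemma hasDerivAt_K (hK : P.ValueC1) {r s t : ℝ} (ht : t ∈ Icc 0 P.T) :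
    HasDerivAt (fun r => P.K r s t) (deriv (fun r => P.K r s t) r) r := by
  refine DifferentiableAt.hasDerivAt (differentiableWithinAt_univ.1 ?_)
  have h1 := (hK.differentiableOn one_ne_zero) (r, s, t) ht
  exact h1.comp (t := {p : ℝ × ℝ × ℝ | p.2.2 ∈ Icc 0 P.T}) (f := fun r : ℝ => (r, s, t)) r
    (by fun_prop) fun _ _ => ht

/-- The first variation of the cost-to-go along perturbations that keep `z_σ(t)`. -/
lemma first_variation (hM : 0 < M) (hP : P.Regular) (hK : P.ValueC1)
    (h : P.IsOptimal 0 x₀ z₀ x z u) {t : ℝ} (ht : t ∈ Ioc 0 P.T) {d e : Fin M → ℝ}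
    {x' z' u' : ℝ → Fin M → ℝ} (h' : P.IsAdmissible t d e x' z' u') (he : ∑ i, e i = 0) :
    ∑ i, (∫ τ in t..P.T, deriv (P.c i) (x τ i) * x' τ i) -
        (∫ τ in t..P.T, deriv P.cg (P.ℓ τ - ∑ i, z τ i) * ∑ i, z' τ i) +
        (∫ τ in t..P.T, 2 * P.κ * ((∑ i, u τ i) - P.dℓ τ) * ∑ i, u' τ i) =
      P.costate x z t * ∑ i, d i := by
  have htI := Ioc_subset_Icc_self ht
  have hadm := h.isAdmissible ht.1
  have h1 := hadm.hasDerivAt_totalCost hP htI h'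
  have hline : HasDerivAt (fun ε : ℝ => (∑ i, x t i) + ε * ∑ i, d i) (∑ i, d i) 0 := by
    simpa using ((hasDerivAt_id (0 : ℝ)).mul_const (∑ i, d i)).const_add (∑ i, x t i)
  have h2 : HasDerivAt (fun ε : ℝ => P.K ((∑ i, x t i) + ε * ∑ i, d i) (∑ i, z t i) t)
      (P.costate x z t * ∑ i, d i) 0 := by
    refine HasDerivAt.comp (h₂ := fun r => P.K r (∑ i, z t i) t) 0 ?_ hline
    simpa [costate] using hasDerivAt_K hK htI (r := ∑ i, x t i) (s := ∑ i, z t i)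
  -- Envelope argument: the perturbed cost is at least `K` at the perturbed sums, with equality at
  -- `ε = 0`. As the `e i` sum to zero, only the first argument of `K` moves.
  have hmin : IsLocalMin ((fun ε : ℝ => P.totalCost t (x + ε • x') (z + ε • z') (u + ε • u')) -
      fun ε : ℝ => P.K ((∑ i, x t i) + ε * ∑ i, d i) (∑ i, z t i) t) 0 := by
    refine Eventually.of_forall fun ε => ?_
    simp only [Pi.sub_apply, zero_smul, add_zero, zero_mul]
    rw [h.K_eq_totalCost hM hP hK ht, sub_self, sub_nonneg]
    have h3 := (hadm.add_smul h' ε).J_le hP ht.2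
    rw [← K_eq_J hM hP htI] at h3
    simpa [Finset.sum_add_distrib, ← Finset.mul_sum, he] using h3
  exact sub_eq_zero.1 (hmin.hasDerivAt_eq_zero (h1.sub h2))

/-- Displace the state of charge of load `k` alone and leave `z` and `u` unchanged: the displacement
decays like `exp(-α_k (τ - t))`, and only `c_k` notices it. -/
lemma costate_eq (hM : 0 < M) (hP : P.Regular) (hK : P.ValueC1)
    (h : P.IsOptimal 0 x₀ z₀ x z u) {t : ℝ} (ht : t ∈ Ioc 0 P.T) (k : Fin M) :
    P.costate x z t =
      ∫ τ in t..P.T, deriv (P.c k) (x τ k) * Real.exp (-P.α k * (τ - t)) := by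
  have hd : ∀ τ, HasDerivAt (fun τ => Real.exp (-P.α k * (τ - t)))
      (-P.α k * Real.exp (-P.α k * (τ - t))) τ := fun τ => by
    have := (((hasDerivAt_id τ).sub_const t).const_mul (-P.α k)).exp
    simpa [mul_comm] using this
  have h' : P.IsAdmissible t (Pi.single k 1) 0
      (fun τ => Pi.single k (Real.exp (-P.α k * (τ - t)))) 0 0 :=
    { u_cont := continuousOn_const
      x_init := by simp
      z_init := rfl
      x_dyn := fun τ _ i => by
        rcases eq_or_ne i k with rfl | hi
        · simpa using (hd τ).hasDerivWithinAt
        · simpa [hi] using hasDerivWithinAt_const τ _ (0 : ℝ)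
      z_dyn := fun τ _ i => by simpa using hasDerivWithinAt_const τ _ (0 : ℝ) }
  have := h.first_variation hM hP hK ht h' (by simp)
  rw [Finset.sum_eq_single k (fun i _ hi => by simp [hi]) (by simp)] at this
  simpa using this.symm

end IsOptimal

/-- `X`, `Z` extend the trajectory to `[0, T]`, and `Λ` is its common costate. -/
structure HasCostate (P : GridModel M) (x₀ z₀ : Fin M → ℝ) (x z X Z : ℝ → Fin M → ℝ)
    (Λ : ℝ → ℝ) : Prop where
  X_cont : ∀ i, ContinuousOn (fun t => X t i) (Icc 0 P.T)
  Z_cont : ∀ i, ContinuousOn (fun t => Z t i) (Icc 0 P.T)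
  X_eq : ∀ t ∈ Ioc 0 P.T, X t = x t
  Z_eq : ∀ t ∈ Ioc 0 P.T, Z t = z t
  X_sum : ∑ i, X 0 i = ∑ i, x₀ i
  Z_sum : ∑ i, Z 0 i = ∑ i, z₀ i
  Λ_cont : ContinuousOn Λ (Icc 0 P.T)
  Λ_final : Λ P.T = 0
  Λ_eq : ∀ t ∈ Ioc 0 P.T, Λ t = P.costate x z t
  Λ_dyn : ∀ i, ∀ t ∈ Ioc 0 P.T,
    HasDerivWithinAt Λ (P.α i * Λ t - deriv (P.c i) (X t i)) (Ioc 0 P.T) t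

lemma exists_extension_pi {T : ℝ} {f : ℝ → Fin M → ℝ} {a : Fin M → ℝ}
    (hf : ContinuousOn f (Ioc 0 T)) (ha : Tendsto f (𝓝[>] 0) (𝓝 a)) :
    ∃ F : ℝ → Fin M → ℝ, (∀ i, ContinuousOn (fun t => F t i) (Icc 0 T)) ∧
      (∀ t ∈ Ioc 0 T, F t = f t) ∧ F 0 = a := by
  choose G hG1 hG2 hG3 using fun i =>
    exists_extension (continuousOn_pi.1 hf i) (tendsto_pi_nhds.1 ha i)
  exact ⟨fun t i => G i t, hG1, fun t ht => funext fun i => hG2 i ht, funext hG3⟩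

lemma Regular.continuous_deriv_c (hP : P.Regular) (i : Fin M) : Continuous (deriv (P.c i)) :=
  (hP.c_C2 i).continuous_deriv one_le_two

lemma Regular.continuous_deriv_cg (hP : P.Regular) : Continuous (deriv P.cg) :=
  hP.cg_C2.continuous_deriv one_le_two

/-- Each `L i` solves the adjoint equation of load `i` up to time `0`. By `costate_eq` they all
coincide on `(0, T]`, so a single `Λ` solves every one of these equations. -/
lemma IsOptimal.exists_hasCostate (hM : 0 < M) (hP : P.Regular) (hK : P.ValueC1)
    (h : P.IsOptimal 0 x₀ z₀ x z u) : ∃ X Z Λ, P.HasCostate x₀ z₀ x z X Z Λ := by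
  obtain ⟨a, ha, hax⟩ := h.x_lim
  obtain ⟨b, hb, hbz⟩ := h.z_lim
  obtain ⟨X, hXc, hXe, hX0⟩ := exists_extension_pi h.x_C1.continuousOn ha
  obtain ⟨Z, hZc, hZe, hZ0⟩ := exists_extension_pi h.z_C1.continuousOn hb
  let L : Fin M → ℝ → ℝ := fun i t =>
    Real.exp (P.α i * t) * ∫ τ in t..P.T, Real.exp (-P.α i * τ) * deriv (P.c i) (X τ i)
  have hLd : ∀ i, ∀ t ∈ Icc 0 P.T,
      HasDerivWithinAt (L i) (P.α i * L i t - deriv (P.c i) (X t i)) (Icc 0 P.T) t := by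
    intro i t ht
    have h1 : HasDerivAt (fun t => Real.exp (P.α i * t)) (Real.exp (P.α i * t) * P.α i) t := by
      simpa using ((hasDerivAt_id t).const_mul (P.α i)).exp
    have hc : ContinuousOn (fun τ => Real.exp (-P.α i * τ) * deriv (P.c i) (X τ i)) (Icc 0 P.T) :=
      (by fun_prop : Continuous fun τ => Real.exp (-P.α i * τ)).continuousOn.mul
        ((hP.continuous_deriv_c i).comp_continuousOn (hXc i))
    refine (h1.hasDerivWithinAt.mul (hasDerivWithinAt_integral_left hc ht)).congr_deriv ?_
    have : Real.exp (P.α i * t) * Real.exp (-P.α i * t) = 1 := by rw [← Real.exp_add]; simp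
    simp only [L]
    linear_combination -deriv (P.c i) (X t i) * this
  have hLe : ∀ i, ∀ t ∈ Ioc 0 P.T, L i t = P.costate x z t := by
    intro i t ht
    rw [h.costate_eq hM hP hK ht i]
    simp only [L]
    rw [← intervalIntegral.integral_const_mul]
    refine integral_congr_Ioc ht.2 fun τ hτ => ?_
    rw [hXe τ ⟨ht.1.trans hτ.1, hτ.2⟩, ← mul_assoc, ← Real.exp_add, mul_comm]
    ring_nf
  refine ⟨X, Z, L ⟨0, hM⟩, hXc, hZc, hXe, hZe, by rw [hX0, hax], by rw [hZ0, hbz],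
    fun t ht => (hLd _ t ht).continuousWithinAt, by simp [L], hLe _, fun i t ht => ?_⟩
  have e : ∀ s ∈ Ioc 0 P.T, L ⟨0, hM⟩ s = L i s := fun s hs => by rw [hLe _ s hs, hLe _ s hs]
  rw [e t ht]
  exact ((hLd i t (Ioc_subset_Icc_self ht)).mono Ioc_subset_Icc_self).congr e (e t ht)

namespace HasCostate

variable {X Z : ℝ → Fin M → ℝ} {Λ : ℝ → ℝ}

lemma deriv_c_cont (hP : P.Regular) (h : P.HasCostate x₀ z₀ x z X Z Λ) (i : Fin M) :
    ContinuousOn (fun t => deriv (P.c i) (X t i)) (Icc 0 P.T) :=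
  (hP.continuous_deriv_c i).comp_continuousOn (h.X_cont i)

lemma Z_sum_cont (h : P.HasCostate x₀ z₀ x z X Z Λ) :
    ContinuousOn (fun t => ∑ i, Z t i) (Icc 0 P.T) :=
  continuousOn_finsetSum _ fun i _ => h.Z_cont i

lemma gen_cont (hP : P.Regular) (h : P.HasCostate x₀ z₀ x z X Z Λ) :
    ContinuousOn (fun t => P.ℓ t - ∑ i, Z t i) (Icc 0 P.T) :=
  hP.ℓ_C1.continuousOn.sub h.Z_sum_cont

lemma deriv_cg_cont (hP : P.Regular) (h : P.HasCostate x₀ z₀ x z X Z Λ) :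
    ContinuousOn (fun t => deriv P.cg (P.ℓ t - ∑ i, Z t i)) (Icc 0 P.T) :=
  hP.continuous_deriv_cg.comp_continuousOn (h.gen_cont hP)

/-- The leakage cancels in `(Λ y)' = -(c_i'(X_i) y + Λ w)`, and `Λ(T) = 0`. This holds for every
trajectory of load `i`, whatever its starting point. -/
lemma integral_adjoint (hP : P.Regular) (h : P.HasCostate x₀ z₀ x z X Z Λ) {s : ℝ} (hs : 0 ≤ s)
    (hsT : s ≤ P.T) (i : Fin M) {y w : ℝ → ℝ} (hy : ContinuousOn y (Icc s P.T))
    (hw : ContinuousOn w (Icc s P.T))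
    (hd : ∀ t ∈ Ioc s P.T, HasDerivWithinAt y (-P.α i * y t - w t) (Ioc s P.T) t) :
    ∫ t in s..P.T, (deriv (P.c i) (X t i) * y t + Λ t * w t) = Λ s * y s := by
  have hI : Icc s P.T ⊆ Icc 0 P.T := Icc_subset_Icc_left hs
  have := integral_eq_sub_of_hasDerivWithinAt_Ioc hsT (f := fun t => Λ t * y t)
    (f' := fun t => -(deriv (P.c i) (X t i) * y t + Λ t * w t)) ((h.Λ_cont.mono hI).mul hy)
    ((((h.deriv_c_cont hP i).mono hI).mul hy).add ((h.Λ_cont.mono hI).mul hw)).neg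
    (fun t ht => (((h.Λ_dyn i t ⟨hs.trans_lt ht.1, ht.2⟩).mono
      (Ioc_subset_Ioc_left hs)).mul (hd t ht)).congr_deriv (by ring))
  rw [intervalIntegral.integral_neg, h.Λ_final] at this
  linarith

end HasCostate

/-- A trajectory with its costates: `Λ` belongs to the states of charge, and `F` to the
generation. -/
structure IsExtremal (P : GridModel M) (x₀ z₀ : Fin M → ℝ) (x z u X Z : ℝ → Fin M → ℝ)
    (Λ F : ℝ → ℝ) : Prop extends P.HasCostate x₀ z₀ x z X Z Λ where
  F_cont : ContinuousOn F (Icc 0 P.T)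
  F_final : F P.T = 0
  F_dyn : ∀ t ∈ Ioc 0 P.T,
    HasDerivWithinAt F (Λ t + deriv P.cg (P.ℓ t - ∑ i, Z t i)) (Ioc 0 P.T) t
  F_eq : ∀ t ∈ Ioc 0 P.T, F t = 2 * P.κ * (P.dℓ t - ∑ i, u t i)

/-- The Euler-Lagrange equation for the generation. -/
lemma IsOptimal.exists_isExtremal (hM : 0 < M) (hP : P.Regular) (hK : P.ValueC1)
    (h : P.IsOptimal 0 x₀ z₀ x z u) : ∃ X Z Λ F, P.IsExtremal x₀ z₀ x z u X Z Λ F := by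
  obtain ⟨X, Z, Λ, hΛ⟩ := h.exists_hasCostate hM hP hK
  let f : ℝ → ℝ := fun t => Λ t + deriv P.cg (P.ℓ t - ∑ i, Z t i)
  have hf : ContinuousOn f (Icc 0 P.T) :=
    hΛ.Λ_cont.add (hΛ.deriv_cg_cont hP)
  let F : ℝ → ℝ := fun t => -∫ τ in t..P.T, f τ
  have hFd : ∀ t ∈ Icc 0 P.T, HasDerivWithinAt F (f t) (Icc 0 P.T) t := fun t ht =>
    (hasDerivWithinAt_integral_left hf ht).neg.congr_deriv (neg_neg _)
  have hFc : ContinuousOn F (Icc 0 P.T) := fun t ht => (hFd t ht).continuousWithinAt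
  refine ⟨X, Z, Λ, F, hΛ, hFc, by simp [F],
    fun t ht => (hFd t (Ioc_subset_Icc_self ht)).mono Ioc_subset_Icc_self, fun r hr => ?_⟩
  -- A start strictly between `0` and `r` avoids the jump and gives a non-degenerate interval
  -- containing `r`, also for `r = T`.
  obtain ⟨t, ht0, htr⟩ := exists_between hr.1
  have htT : t < P.T := htr.trans_le hr.2
  have hI : Icc t P.T ⊆ Icc 0 P.T := Icc_subset_Icc_left ht0.le
  have hIoc : Icc t P.T ⊆ Ioc 0 P.T := fun s hs => ⟨ht0.trans_le hs.1, hs.2⟩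
  have hadm := h.isAdmissible ht0
  let v : ℝ → ℝ := fun t => 2 * P.κ * ((∑ i, u t i) - P.dℓ t)
  have hv : ContinuousOn v (Icc t P.T) :=
    continuousOn_const.mul (hadm.u_sum_cont.sub (hP.continuousOn_dℓ.mono hI))
  have hφ : ContinuousOn (fun t => F t + v t) (Icc t P.T) := (hFc.mono hI).add hv
  let k : Fin M := ⟨0, hM⟩
  -- The tested direction is the residual `F + v` itself, fed into one load, so that the first
  -- variation becomes `∫ (F + v)² = 0`.
  obtain ⟨x', z', h'⟩ := exists_isAdmissible (P := P) (t₀ := t) 0 0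
    (u := fun τ => Pi.single k (F τ + v τ)) (continuousOn_pi.2 fun i => by
      rcases eq_or_ne i k with rfl | hi
      · simpa using hφ
      · simpa [hi] using continuousOn_const)
  have hvar := h.first_variation hM hP hK ⟨ht0, htT.le⟩ h' (by simp)
  have hadj : ∀ i, ∫ τ in t..P.T, deriv (P.c i) (x τ i) * x' τ i =
      -∫ τ in t..P.T, Λ τ * z' τ i := fun i => by
    have h1 := hΛ.integral_adjoint hP ht0.le htT.le i (h'.x_cont i) (h'.z_cont i)
      (fun τ hτ => (h'.x_dyn τ (Ioc_subset_Icc_self hτ) i).mono Ioc_subset_Icc_self)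
    rw [intervalIntegral.integral_add
      ((((hΛ.deriv_c_cont hP i).mono hI).fun_mul (h'.x_cont i)).intervalIntegrable_Icc htT.le)
      (((hΛ.Λ_cont.mono hI).fun_mul (h'.z_cont i)).intervalIntegrable_Icc htT.le),
      h'.x_init] at h1
    rw [integral_congr_Ioc htT.le (g := fun τ => deriv (P.c i) (X τ i) * x' τ i) fun τ hτ => by
      simp only [hΛ.X_eq τ (hIoc (Ioc_subset_Icc_self hτ))]]
    simp only [Pi.zero_apply, mul_zero] at h1
    linarith
  have hΛz : ∀ i, ContinuousOn (fun τ => Λ τ * z' τ i) (Icc t P.T) := fun i =>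
    (hΛ.Λ_cont.mono hI).fun_mul (h'.z_cont i)
  have hsum : ∑ i, ∫ τ in t..P.T, deriv (P.c i) (x τ i) * x' τ i =
      -∫ τ in t..P.T, Λ τ * ∑ i, z' τ i := by
    simp only [hadj, Finset.sum_neg_distrib, Finset.mul_sum]
    rw [intervalIntegral.integral_finsetSum fun i _ => (hΛz i).intervalIntegrable_Icc htT.le]
  have hcg : ∫ τ in t..P.T, deriv P.cg (P.ℓ τ - ∑ i, z τ i) * ∑ i, z' τ i =
      ∫ τ in t..P.T, deriv P.cg (P.ℓ τ - ∑ i, Z τ i) * ∑ i, z' τ i :=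
    integral_congr_Ioc htT.le fun τ hτ => by
      simp only [hΛ.Z_eq τ (hIoc (Ioc_subset_Icc_self hτ))]
  -- Integration by parts of `F z'_σ`; both boundary terms vanish, as `z'_σ(t) = 0` and `F(T) = 0`.
  have hparts := integral_eq_sub_of_hasDerivWithinAt_Ioc htT.le
    (f := fun τ => F τ * ∑ i, z' τ i)
    (f' := fun τ => f τ * ∑ i, z' τ i + F τ * (F τ + v τ))
    ((hFc.mono hI).fun_mul h'.z_sum_cont)
    (((hf.mono hI).fun_mul h'.z_sum_cont).add ((hFc.mono hI).fun_mul hφ))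
    (fun τ hτ => by
      have h1 : HasDerivWithinAt (fun τ => ∑ i, z' τ i)
          (∑ i, (Pi.single k (F τ + v τ) : Fin M → ℝ) i) (Ioc t P.T) τ :=
        HasDerivWithinAt.fun_sum fun i _ =>
          (h'.z_dyn τ (Ioc_subset_Icc_self hτ) i).mono Ioc_subset_Icc_self
      rw [Finset.sum_pi_single'] at h1
      exact ((hFd τ (hI (Ioc_subset_Icc_self hτ))).mono (Ioc_subset_Icc_self.trans hI)).mul
        (by simpa using h1))
  have hz0 : ∑ i, z' t i = 0 := by simp [h'.z_init]
  have hF0 : F P.T = 0 := by simp [F]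
  rw [intervalIntegral.integral_add
    (((hf.mono hI).fun_mul h'.z_sum_cont).intervalIntegrable_Icc htT.le)
    (((hFc.mono hI).fun_mul hφ).intervalIntegrable_Icc htT.le), hz0, hF0] at hparts
  have hfz : ∫ τ in t..P.T, f τ * ∑ i, z' τ i = (∫ τ in t..P.T, Λ τ * ∑ i, z' τ i) +
      ∫ τ in t..P.T, deriv P.cg (P.ℓ τ - ∑ i, Z τ i) * ∑ i, z' τ i := by
    rw [← intervalIntegral.integral_add
      (((hΛ.Λ_cont.mono hI).fun_mul h'.z_sum_cont).intervalIntegrable_Icc htT.le)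
      ((((hΛ.deriv_cg_cont hP).mono hI).fun_mul
        h'.z_sum_cont).intervalIntegrable_Icc htT.le)]
    simp only [f, add_mul]
  have hzero : ∫ τ in t..P.T, (F τ + v τ) ^ 2 = 0 := by
    have : ∫ τ in t..P.T, (F τ + v τ) ^ 2 =
        (∫ τ in t..P.T, F τ * (F τ + v τ)) + ∫ τ in t..P.T, v τ * (F τ + v τ) := by
      rw [← intervalIntegral.integral_add
        (((hFc.mono hI).fun_mul hφ).intervalIntegrable_Icc htT.le)
        ((hv.fun_mul hφ).intervalIntegrable_Icc htT.le)]
      exact intervalIntegral.integral_congr fun τ _ => by ring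
    rw [this]
    simp only [hsum, hcg, Finset.sum_pi_single', Finset.mem_univ, if_true, Pi.zero_apply,
      Finset.sum_const_zero, mul_zero] at hvar
    simp only [mul_zero, zero_mul, sub_zero] at hparts
    simp only [v] at hvar hparts ⊢
    linarith
  have := eqOn_zero_of_integral_sq_nonpos htT hφ hzero.le r ⟨htr.le, hr.2⟩
  simp only [v] at this
  linarith

end GridModel

/-! ### Weak duality, and the payoffs at the price `-Λ`. -/

namespace GridModel

variable {M : ℕ} {P : GridModel M} {x₀ z₀ : Fin M → ℝ} {x z u X Z : ℝ → Fin M → ℝ}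
  {Λ F : ℝ → ℝ}

lemma supplierPayoff_congr (hT : 0 ≤ P.T) {ϱ ϱ' g g' γ γ' : ℝ → ℝ} (hϱ : EqOn ϱ ϱ' (Ioc 0 P.T))
    (hg : EqOn g g' (Ioc 0 P.T)) (hγ : EqOn γ γ' (Ioc 0 P.T)) :
    P.supplierPayoff ϱ g γ = P.supplierPayoff ϱ' g' γ' :=
  integral_congr_Ioc hT fun t ht => by simp only [hϱ ht, hg ht, hγ ht]

lemma loadPayoff_congr (hT : 0 ≤ P.T) {i : Fin M} {c p a : ℝ} {ϱ ϱ' y y' w w' : ℝ → ℝ}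
    (hϱ : EqOn ϱ ϱ' (Ioc 0 P.T)) (hy : EqOn y y' (Ioc 0 P.T)) (hw : EqOn w w' (Ioc 0 P.T)) :
    P.loadPayoff i c p a ϱ y w = P.loadPayoff i c p a ϱ' y' w' := by
  simp only [loadPayoff]
  rw [integral_congr_Ioc hT (g := fun t => -P.c i (y' t) + ϱ' t * w' t) fun t ht => by
    simp only [hϱ ht, hy ht, hw ht]]

lemma IsGeneration.exists_extension {g₀ : ℝ} {g γ : ℝ → ℝ} (h : P.IsGeneration g₀ g γ) :
    ∃ g' γ' : ℝ → ℝ, ContinuousOn g' (Icc 0 P.T) ∧ ContinuousOn γ' (Icc 0 P.T) ∧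
      EqOn g' g (Ioc 0 P.T) ∧ EqOn γ' γ (Ioc 0 P.T) ∧ g' 0 = g₀ ∧
      ∀ t ∈ Ioc 0 P.T, HasDerivWithinAt g' (γ' t) (Ioc 0 P.T) t := by
  obtain ⟨b, hb⟩ := h.γ_lim
  obtain ⟨γ', hγ1, hγ2, -⟩ := GridModel.exists_extension h.γ_cont hb
  obtain ⟨g', hg1, hg2, hg3⟩ := GridModel.exists_extension
    (fun t ht => (h.g_dyn t ht).continuousWithinAt) h.g_lim
  exact ⟨g', γ', hg1, hγ1, hg2, hγ2, hg3, fun t ht => by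
    rw [hγ2 ht]; exact (h.g_dyn t ht).congr hg2 (hg2 ht)⟩

lemma IsLoad.exists_extension {i : Fin M} {a : ℝ} {y w : ℝ → ℝ} (h : P.IsLoad i a y w) :
    ∃ y' w' : ℝ → ℝ, ContinuousOn y' (Icc 0 P.T) ∧ ContinuousOn w' (Icc 0 P.T) ∧
      EqOn y' y (Ioc 0 P.T) ∧ EqOn w' w (Ioc 0 P.T) ∧ y' 0 = a ∧
      ∀ t ∈ Ioc 0 P.T, HasDerivWithinAt y' (-P.α i * y' t - w' t) (Ioc 0 P.T) t := by
  obtain ⟨b, hb⟩ := h.z_lim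
  obtain ⟨w', hw1, hw2, -⟩ := GridModel.exists_extension h.z_cont hb
  obtain ⟨y', hy1, hy2, hy3⟩ := GridModel.exists_extension
    (fun t ht => (h.x_dyn t ht).continuousWithinAt) h.x_lim
  exact ⟨y', w', hy1, hw1, hy2, hw2, hy3, fun t ht => by
    rw [hy2 ht, hw2 ht]; exact (h.x_dyn t ht).congr hy2 (hy2 ht)⟩

lemma tendsto_of_continuousOn_Icc {T : ℝ} (hT : 0 < T) {f g : ℝ → ℝ} (hf : ContinuousOn f (Icc 0 T))
    (hfg : EqOn g f (Ioc 0 T)) : Tendsto g (𝓝[>] 0) (𝓝 (f 0)) := by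
  have h1 : Tendsto f (𝓝[>] 0) (𝓝 (f 0)) := by
    refine (hf 0 (left_mem_Icc.2 hT.le)).tendsto.mono_left ?_
    rw [← nhdsWithin_Ioc_eq_nhdsGT hT]
    exact nhdsWithin_mono _ Ioc_subset_Icc_self
  refine h1.congr' ?_
  filter_upwards [Ioc_mem_nhdsGT hT] with t ht using (hfg ht).symm

/-- The dual functional never exceeds the optimal cost. -/
lemma dual_le_J (hP : P.Regular) (ϱ : ℝ → ℝ) :
    P.dual x₀ z₀ ϱ ≤ ((P.J x₀ z₀ 0 : ℝ) : EReal) := by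
  have hle : ∀ v ∈ {v | ∃ x z u, P.IsAdmissible 0 x₀ z₀ x z u ∧ v = P.totalCost 0 x z u},
      P.dual x₀ z₀ ϱ ≤ (v : EReal) := by
    rintro _ ⟨x, z, u, h, rfl⟩
    -- With generation defined by the power balance, the multiplier term is zero and the Lagrangian
    -- is the cost.
    refine sInf_le ⟨fun t => P.ℓ t - ∑ i, z t i, fun t => P.dℓ t - ∑ i, u t i, x, z, u,
      ⟨hP.continuousOn_dℓ.sub h.u_sum_cont, by simp [h.z_init], fun t ht =>
        (hP.hasDerivWithinAt_ℓ ht).sub (HasDerivWithinAt.fun_sum fun i _ => h.z_dyn t ht i), h⟩, ?_⟩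
    congr 1
    refine intervalIntegral.integral_congr fun t _ => ?_
    simp only [runningCost, cd]
    ring
  by_cases hbot : P.dual x₀ z₀ ϱ = ⊥
  · simp [hbot]
  have htop : P.dual x₀ z₀ ϱ ≠ ⊤ := by
    obtain ⟨v, hv⟩ := nonempty_J (P := P) (t₀ := 0) (x₀ := x₀) (z₀ := z₀)
    exact ((hle v hv).trans_lt (EReal.coe_lt_top v)).ne
  rw [← EReal.coe_toReal htop hbot, EReal.coe_le_coe_iff]
  refine le_csInf nonempty_J fun v hv => ?_
  rw [← EReal.coe_le_coe_iff, EReal.coe_toReal htop hbot]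
  exact hle v hv

namespace IsExtremal

/-- Tangent inequalities at `G` and `Γ` leave the linear term `(Λ + c_g'(G))(g - G) + F (γ - Γ)`. It
is the derivative of `F (g - G)`, which vanishes at `0` by the common initial value and at `T` by
`F(T) = 0`. -/
lemma supplier_bound (hP : P.Regular) (h : P.IsExtremal x₀ z₀ x z u X Z Λ F) {μ : ℝ}
    (hμ : ∀ y, μ ≤ deriv (deriv P.cg) y) {g γ : ℝ → ℝ} (hg : ContinuousOn g (Icc 0 P.T))
    (hγ : ContinuousOn γ (Icc 0 P.T)) (hg0 : g 0 = P.ℓ 0 - ∑ i, z₀ i)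
    (hd : ∀ t ∈ Ioc 0 P.T, HasDerivWithinAt g (γ t) (Ioc 0 P.T) t)
    (hdG : ∀ t ∈ Ioc 0 P.T, HasDerivWithinAt (fun t => P.ℓ t - ∑ i, Z t i)
      (F t / (2 * P.κ)) (Ioc 0 P.T) t) :
    P.supplierPayoff (-Λ) g γ + μ / 2 * ∫ t in 0..P.T, (g t - (P.ℓ t - ∑ i, Z t i)) ^ 2 ≤
      P.supplierPayoff (-Λ) (fun t => P.ℓ t - ∑ i, Z t i) (fun t => F t / (2 * P.κ)) := by
  have hT := hP.T_pos.le
  have hGc := h.gen_cont hP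
  have hcgc := h.deriv_cg_cont hP
  set G : ℝ → ℝ := fun t => P.ℓ t - ∑ i, Z t i with hG
  set Γ : ℝ → ℝ := fun t => F t / (2 * P.κ) with hΓ
  have hΓc : ContinuousOn Γ (Icc 0 P.T) := h.F_cont.div_const _
  have hηc : ContinuousOn (fun t => g t - G t) (Icc 0 P.T) := hg.sub hGc
  have hpay : ∀ {g γ : ℝ → ℝ}, ContinuousOn g (Icc 0 P.T) → ContinuousOn γ (Icc 0 P.T) →
      IntervalIntegrable (fun t => -P.cg (g t) - P.cd (γ t) + (-Λ) t * g t) volume 0 P.T :=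
    fun {g γ} hg hγ => (((hP.cg_C2.continuous.comp_continuousOn hg).neg.sub
      (contDiff_cd.continuous.comp_continuousOn hγ)).add
        (h.Λ_cont.neg.mul hg)).intervalIntegrable_Icc hT
  have hsq : IntervalIntegrable (fun t => μ / 2 * (g t - G t) ^ 2) volume 0 P.T :=
    (continuousOn_const.mul (hηc.pow 2)).intervalIntegrable_Icc hT
  have hlin : ContinuousOn (fun t => (Λ t + deriv P.cg (G t)) * (g t - G t) +
      F t * (γ t - Γ t)) (Icc 0 P.T) :=
    ((h.Λ_cont.add hcgc).mul hηc).add (h.F_cont.mul (hγ.sub hΓc))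
  have hzero : ∫ t in 0..P.T, ((Λ t + deriv P.cg (G t)) * (g t - G t) + F t * (γ t - Γ t)) = 0 := by
    rw [integral_eq_sub_of_hasDerivWithinAt_Ioc hT (f := fun t => F t * (g t - G t))
      (h.F_cont.mul hηc) hlin fun t ht => (h.F_dyn t ht).mul ((hd t ht).sub (hdG t ht))]
    rw [h.F_final, hg0, hG]
    simp [h.Z_sum]
  have hmono := intervalIntegral.integral_mono_on hT ((hpay hg hγ).add hsq)
    ((hpay hGc hΓc).sub (hlin.intervalIntegrable_Icc hT)) fun t ht => by
      have h1 := add_deriv_mul_le_of_strongly_convex hP.cg_C2 hμ (G t) (g t)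
      have h2 : P.cd (Γ t) + F t * (γ t - Γ t) ≤ P.cd (γ t) := by
        have hκ := hP.κ_pos
        have hF : F t = 2 * P.κ * Γ t := by simp only [hΓ]; field_simp
        rw [hF]
        simp only [cd]
        nlinarith [mul_nonneg hκ.le (sq_nonneg (γ t - Γ t))]
      simp only [Pi.neg_apply]
      linarith
  rw [intervalIntegral.integral_add (hpay hg hγ) hsq, intervalIntegral.integral_sub
    (hpay hGc hΓc) (hlin.intervalIntegrable_Icc hT), hzero, sub_zero,
    intervalIntegral.integral_const_mul] at hmono
  exact hmono

/-- The adjoint identity replaces `-∫ Λ w` by `∫ c_i'(X_i) y - Λ(0) y(0)`, and the impulse term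
cancels `Λ(0) y(0)`. Neither `w` nor the starting point remains. -/
lemma loadPayoff_eq (hP : P.Regular) (h : P.IsExtremal x₀ z₀ x z u X Z Λ F) (i : Fin M) (c : ℝ)
    {y w : ℝ → ℝ} (hy : ContinuousOn y (Icc 0 P.T)) (hw : ContinuousOn w (Icc 0 P.T))
    (hd : ∀ t ∈ Ioc 0 P.T, HasDerivWithinAt y (-P.α i * y t - w t) (Ioc 0 P.T) t) :
    P.loadPayoff i c (-Λ 0) (y 0) (-Λ) y w =
      (∫ t in 0..P.T, (-P.c i (y t) + deriv (P.c i) (X t i) * y t)) - Λ 0 * c := by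
  have hT := hP.T_pos.le
  have h1 := h.integral_adjoint hP le_rfl hT i hy hw hd
  have h2 : ContinuousOn (fun t => -P.c i (y t) + deriv (P.c i) (X t i) * y t) (Icc 0 P.T) :=
    ((hP.c_C2 i).continuous.comp_continuousOn hy).neg.add ((h.deriv_c_cont hP i).mul hy)
  have h3 : ContinuousOn (fun t => deriv (P.c i) (X t i) * y t + Λ t * w t) (Icc 0 P.T) :=
    ((h.deriv_c_cont hP i).mul hy).add (h.Λ_cont.mul hw)
  have h4 : ∫ t in 0..P.T, (-P.c i (y t) + (-Λ) t * w t) =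
      (∫ t in 0..P.T, (-P.c i (y t) + deriv (P.c i) (X t i) * y t)) - Λ 0 * y 0 := by
    rw [← h1, ← intervalIntegral.integral_sub (h2.intervalIntegrable_Icc hT)
      (h3.intervalIntegrable_Icc hT)]
    refine intervalIntegral.integral_congr fun t _ => ?_
    simp only [Pi.neg_apply]
    ring
  rw [loadPayoff, h4]
  ring

/-- By `loadPayoff_eq` the integrand is `-c_i(y) + c_i'(X_i) y` up to a constant, which is maximal
at `y = X_i` pointwise in time. -/
lemma load_bound (hP : P.Regular) (h : P.IsExtremal x₀ z₀ x z u X Z Λ F) (i : Fin M) {μ : ℝ}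
    (hμ : ∀ y, μ ≤ deriv (deriv (P.c i)) y) (c : ℝ)
    {y w : ℝ → ℝ} (hy : ContinuousOn y (Icc 0 P.T)) (hw : ContinuousOn w (Icc 0 P.T))
    (hd : ∀ t ∈ Ioc 0 P.T, HasDerivWithinAt y (-P.α i * y t - w t) (Ioc 0 P.T) t)
    (hdX : ∀ t ∈ Ioc 0 P.T,
      HasDerivWithinAt (fun t => X t i) (-P.α i * X t i - Z t i) (Ioc 0 P.T) t) :
    P.loadPayoff i c (-Λ 0) (y 0) (-Λ) y w + μ / 2 * ∫ t in 0..P.T, (y t - X t i) ^ 2 ≤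
      P.loadPayoff i c (-Λ 0) (X 0 i) (-Λ) (fun t => X t i) (fun t => Z t i) := by
  have hT := hP.T_pos.le
  have hc : ∀ {y : ℝ → ℝ}, ContinuousOn y (Icc 0 P.T) →
      IntervalIntegrable (fun t => -P.c i (y t) + deriv (P.c i) (X t i) * y t) volume 0 P.T :=
    fun {y} hy => (((hP.c_C2 i).continuous.comp_continuousOn hy).neg.add
      ((h.deriv_c_cont hP i).mul hy)).intervalIntegrable_Icc hT
  have hsq : IntervalIntegrable (fun t => μ / 2 * (y t - X t i) ^ 2) volume 0 P.T :=
    (continuousOn_const.mul ((hy.sub (h.X_cont i)).pow 2)).intervalIntegrable_Icc hT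
  rw [h.loadPayoff_eq hP i c hy hw hd, h.loadPayoff_eq hP i c (h.X_cont i) (h.Z_cont i) hdX,
    ← intervalIntegral.integral_const_mul]
  have := intervalIntegral.integral_mono_on hT ((hc hy).add hsq) (hc (h.X_cont i)) fun t _ => by
    have := add_deriv_mul_le_of_strongly_convex (hP.c_C2 i) hμ (X t i) (y t)
    linarith
  rw [intervalIntegral.integral_add (hc hy) hsq] at this
  linarith

/-- The relaxed problem decouples into supplier and loads. The terms `Λ(0) (y_i(0) - x₀_i)` undo the
impulse terms, which the Lagrangian does not contain. -/
lemma lagrangian_eq (hP : P.Regular) (h : P.IsExtremal x₀ z₀ x z u X Z Λ F) {g γ : ℝ → ℝ}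
    {y w : ℝ → Fin M → ℝ} (hg : ContinuousOn g (Icc 0 P.T)) (hγ : ContinuousOn γ (Icc 0 P.T))
    (hy : ∀ i, ContinuousOn (fun t => y t i) (Icc 0 P.T))
    (hw : ∀ i, ContinuousOn (fun t => w t i) (Icc 0 P.T)) :
    P.lagrangian (-Λ) g γ y w = -P.supplierPayoff (-Λ) g γ -
      ∑ i, (P.loadPayoff i (x₀ i) (-Λ 0) (y 0 i) (-Λ) (fun t => y t i) (fun t => w t i) -
        Λ 0 * (y 0 i - x₀ i)) - ∫ t in 0..P.T, Λ t * P.ℓ t := by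
  have hT := hP.T_pos.le
  have h1 : IntervalIntegrable (fun t => -P.cg (g t) - P.cd (γ t) + (-Λ) t * g t) volume 0 P.T :=
    (((hP.cg_C2.continuous.comp_continuousOn hg).neg.sub
      (contDiff_cd.continuous.comp_continuousOn hγ)).add
        (h.Λ_cont.neg.mul hg)).intervalIntegrable_Icc hT
  have h2 : ∀ i, ContinuousOn (fun t => -P.c i (y t i) + (-Λ) t * w t i) (Icc 0 P.T) := fun i =>
    ((hP.c_C2 i).continuous.comp_continuousOn (hy i)).neg.add (h.Λ_cont.neg.mul (hw i))
  have h3 : IntervalIntegrable (fun t => Λ t * P.ℓ t) volume 0 P.T :=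
    (h.Λ_cont.mul hP.ℓ_C1.continuousOn).intervalIntegrable_Icc hT
  have h2' : IntervalIntegrable (fun t => ∑ i, (-P.c i (y t i) + (-Λ) t * w t i)) volume 0 P.T :=
    (continuousOn_finsetSum _ fun i _ => h2 i).intervalIntegrable_Icc hT
  have e : ∑ i, (P.loadPayoff i (x₀ i) (-Λ 0) (y 0 i) (-Λ) (fun t => y t i) (fun t => w t i) -
      Λ 0 * (y 0 i - x₀ i)) = ∫ t in 0..P.T, ∑ i, (-P.c i (y t i) + (-Λ) t * w t i) := by
    rw [intervalIntegral.integral_finsetSum fun i _ => (h2 i).intervalIntegrable_Icc hT]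
    refine Finset.sum_congr rfl fun i _ => ?_
    rw [loadPayoff]
    ring
  rw [e, lagrangian, supplierPayoff, neg_sub_left, ← intervalIntegral.integral_add h2' h1,
    ← neg_add', ← intervalIntegral.integral_add (h2'.add h1) h3, ← intervalIntegral.integral_neg]
  refine intervalIntegral.integral_congr fun t _ => ?_
  simp only [Pi.neg_apply, cX, Finset.sum_add_distrib, ← Finset.mul_sum, Finset.sum_neg_distrib]
  ring

end IsExtremal

end GridModel

/-! ### Strong duality and the competitive equilibrium. -/

theorem proposition4 {M : ℕ} (hM : 0 < M) (P : GridModel M) (hP : P.Regular)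
    (hsolv : P.UniquelySolvable) (hK : P.ValueC1)
    (x₀ z₀ : Fin M → ℝ) (x z u : ℝ → Fin M → ℝ) (hopt : P.IsOptimal 0 x₀ z₀ x z u)
    (hcostate : ContDiffOn ℝ 2 (P.costate x z) (Set.Ioc 0 P.T))
    (ϱ : ℝ → ℝ) (hϱ : ∀ t ∈ Set.Ioc 0 P.T, ϱ t = -P.costate x z t) :
    P.IsMultiplier ϱ ∧
    (∀ ϱ', P.IsMultiplier ϱ' → P.dual x₀ z₀ ϱ' ≤ P.dual x₀ z₀ ϱ) ∧
    P.dual x₀ z₀ ϱ = ((P.J x₀ z₀ 0 : ℝ) : EReal) ∧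
    P.IsEquilibrium x₀ z₀ ϱ (fun t => P.ℓ t - ∑ i, z t i) (fun t => P.dℓ t - ∑ i, u t i) x z := by
  obtain ⟨X, Z, Λ, F, h⟩ := hopt.exists_isExtremal hM hP hK
  obtain ⟨μ, hμ0, hμc, hμg⟩ := hP.strongly_convex
  have hT := hP.T_pos.le
  have hκ := hP.κ_pos
  have hϱΛ : EqOn ϱ (-Λ) (Ioc 0 P.T) := fun t ht => by
    rw [hϱ t ht, Pi.neg_apply, h.Λ_eq t ht]
  have hgG : EqOn (fun t => P.ℓ t - ∑ i, z t i) (fun t => P.ℓ t - ∑ i, Z t i) (Ioc 0 P.T) :=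
    fun t ht => by simp only [h.Z_eq t ht]
  have hγΓ : EqOn (fun t => P.dℓ t - ∑ i, u t i) (fun t => F t / (2 * P.κ)) (Ioc 0 P.T) :=
    fun t ht => by
      simp only [h.F_eq t ht]
      field_simp
  have hxX : ∀ i, EqOn (fun t => x t i) (fun t => X t i) (Ioc 0 P.T) := fun i t ht => by
    simp only [h.X_eq t ht]
  have hzZ : ∀ i, EqOn (fun t => z t i) (fun t => Z t i) (Ioc 0 P.T) := fun i t ht => by
    simp only [h.Z_eq t ht]
  have hgd : ∀ t ∈ Ioc 0 P.T, HasDerivWithinAt (fun t => P.ℓ t - ∑ i, z t i)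
      (P.dℓ t - ∑ i, u t i) (Ioc 0 P.T) t := fun t ht =>
    ((hP.hasDerivWithinAt_ℓ (Ioc_subset_Icc_self ht)).mono Ioc_subset_Icc_self).sub
      (HasDerivWithinAt.fun_sum fun i _ => hopt.z_dyn t ht i)
  have hdG : ∀ t ∈ Ioc 0 P.T, HasDerivWithinAt (fun t => P.ℓ t - ∑ i, Z t i)
      (F t / (2 * P.κ)) (Ioc 0 P.T) t := fun t ht =>
    ((hgd t ht).congr hgG.symm (hgG.symm ht)).congr_deriv (hγΓ ht)
  have hdX : ∀ i, ∀ t ∈ Ioc 0 P.T,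
      HasDerivWithinAt (fun t => X t i) (-P.α i * X t i - Z t i) (Ioc 0 P.T) t := fun i t ht => by
    rw [h.X_eq t ht, h.Z_eq t ht]
    exact (hopt.x_dyn t ht i).congr (hxX i).symm ((hxX i).symm ht)
  have hΓc : ContinuousOn (fun t => F t / (2 * P.κ)) (Icc 0 P.T) := h.F_cont.div_const _
  -- Because of its jump the optimal allocation need not be feasible for the relaxed problem; it
  -- serves only as the reference point for the lower bound.
  have hJ : P.lagrangian (-Λ) (fun t => P.ℓ t - ∑ i, Z t i) (fun t => F t / (2 * P.κ)) X Z =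
      P.J x₀ z₀ 0 := by
    rw [← hopt.cost_eq]
    refine GridModel.integral_congr_Ioc hT fun t ht => ?_
    simp only [GridModel.runningCost, h.X_eq t ht, h.Z_eq t ht, ← hγΓ ht, GridModel.cd]
    ring
  have hdual : P.dual x₀ z₀ ϱ = ((P.J x₀ z₀ 0 : ℝ) : EReal) := by
    refine le_antisymm (GridModel.dual_le_J hP ϱ) (le_sInf ?_)
    rintro _ ⟨g, γ, y, w, v, hf, rfl⟩
    rw [EReal.coe_le_coe_iff]
    have hgc : ContinuousOn g (Icc 0 P.T) := fun t ht => (hf.g_dyn t ht).continuousWithinAt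
    have e : P.lagrangian ϱ g γ y w = P.lagrangian (-Λ) g γ y w :=
      GridModel.integral_congr_Ioc hT fun t ht => by simp only [hϱΛ ht]
    rw [e, ← hJ, h.lagrangian_eq hP hgc hf.γ_cont hf.loads.x_cont hf.loads.z_cont,
      h.lagrangian_eq hP (h.gen_cont hP) hΓc h.X_cont h.Z_cont]
    have h1 := h.supplier_bound hP hμg hgc hf.γ_cont hf.g_init
      (fun t ht => (hf.g_dyn t (Ioc_subset_Icc_self ht)).mono Ioc_subset_Icc_self) hdG
    have h1' : 0 ≤ μ / 2 * ∫ t in 0..P.T, (g t - (P.ℓ t - ∑ i, Z t i)) ^ 2 :=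
      mul_nonneg (by positivity) (intervalIntegral.integral_nonneg hT fun _ _ => sq_nonneg _)
    have h2 := Finset.sum_le_sum fun i (_ : i ∈ Finset.univ) =>
      (le_add_of_nonneg_right (mul_nonneg (by positivity) (intervalIntegral.integral_nonneg hT
        fun _ _ => sq_nonneg _))).trans (h.load_bound hP i (hμc i) (x₀ i) (hf.loads.x_cont i)
          (hf.loads.z_cont i) (fun t ht => (hf.loads.x_dyn t (Ioc_subset_Icc_self ht) i).mono
            Ioc_subset_Icc_self) (hdX i))
    -- The individual jumps at time `0` preserve `x_σ`, and all loads face the same `Λ 0`.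
    have h3 : ∑ i, Λ 0 * (X 0 i - x₀ i) = 0 := by
      rw [← Finset.mul_sum, Finset.sum_sub_distrib, h.X_sum, sub_self, mul_zero]
    have h4 : ∑ i, Λ 0 * (y 0 i - x₀ i) = 0 := by simp [hf.loads.x_init]
    rw [Finset.sum_sub_distrib, Finset.sum_sub_distrib, h3, h4]
    linarith
  refine ⟨?_, fun ϱ' _ => hdual ▸ GridModel.dual_le_J hP ϱ', hdual, ?_⟩
  · refine (h.Λ_cont.neg.intervalIntegrable_Icc hT).congr fun t ht => ?_
    rw [uIoc_of_le hT] at ht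
    exact (hϱΛ ht).symm
  refine ⟨fun t _ => by ring, ⟨?_, ⟨F 0 / (2 * P.κ), ?_⟩, ?_, hgd⟩, fun g γ hg => ?_,
    -Λ 0, ?_, fun i => ⟨X 0 i, ⟨?_, ⟨Z 0 i, ?_⟩, ?_, fun t ht => hopt.x_dyn t ht i⟩,
      fun a y w hy => ?_⟩⟩
  · exact (hΓc.mono Ioc_subset_Icc_self).congr hγΓ
  · exact GridModel.tendsto_of_continuousOn_Icc hP.T_pos hΓc hγΓ
  · rw [← h.Z_sum]
    exact GridModel.tendsto_of_continuousOn_Icc hP.T_pos (h.gen_cont hP) hgG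
  · obtain ⟨g', γ', hg1, hγ1, hg2, hγ2, hg0, hgd'⟩ := hg.exists_extension
    have hb := h.supplier_bound hP hμg hg1 hγ1 hg0 hgd' hdG
    rw [GridModel.supplierPayoff_congr hT hϱΛ hg2.symm hγ2.symm,
      GridModel.supplierPayoff_congr hT hϱΛ hgG hγΓ]
    have h0 : 0 ≤ ∫ t in 0..P.T, (g' t - (P.ℓ t - ∑ i, Z t i)) ^ 2 :=
      intervalIntegral.integral_nonneg hT fun _ _ => sq_nonneg _
    refine ⟨by nlinarith, fun heq t ht => ?_⟩
    have := GridModel.eqOn_zero_of_integral_sq_nonpos hP.T_pos (hg1.fun_sub (h.gen_cont hP))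
      (by nlinarith) t (Ioc_subset_Icc_self ht)
    rw [← hg2 ht, hgG ht]
    exact sub_eq_zero.1 this
  · exact GridModel.tendsto_of_continuousOn_Icc hP.T_pos h.Λ_cont.neg hϱΛ
  · exact ((h.Z_cont i).mono Ioc_subset_Icc_self).congr (hzZ i)
  · exact GridModel.tendsto_of_continuousOn_Icc hP.T_pos (h.Z_cont i) (hzZ i)
  · exact GridModel.tendsto_of_continuousOn_Icc hP.T_pos (h.X_cont i) (hxX i)
  · obtain ⟨y', w', hy1, hw1, hy2, hw2, hy0, hyd⟩ := hy.exists_extension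
    have hb := h.load_bound hP i (hμc i) (x₀ i) hy1 hw1 hyd (hdX i)
    rw [hy0] at hb
    rw [GridModel.loadPayoff_congr hT hϱΛ hy2.symm hw2.symm,
      GridModel.loadPayoff_congr hT hϱΛ (hxX i) (hzZ i)]
    have h0 : 0 ≤ ∫ t in 0..P.T, (y' t - X t i) ^ 2 :=
      intervalIntegral.integral_nonneg hT fun _ _ => sq_nonneg _
    refine ⟨by nlinarith, fun heq => ?_⟩
    have hyx : EqOn y (fun t => x t i) (Ioc 0 P.T) := fun t ht => by
      have := GridModel.eqOn_zero_of_integral_sq_nonpos hP.T_pos (hy1.fun_sub (h.X_cont i))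
        (by nlinarith) t (Ioc_subset_Icc_self ht)
      rw [← hy2 ht, hxX i ht]
      exact sub_eq_zero.1 this
    refine ⟨hyx, fun t ht => ?_⟩
    -- Strong convexity determines only the state of charge; `z` is then recovered from the state
    -- equation.
    have h1 := (uniqueDiffOn_Ioc 0 P.T t ht).eq_deriv _ (hy.x_dyn t ht)
      ((hopt.x_dyn t ht i).congr hyx (hyx ht))
    have h2 := hyx ht
    simp only at h2 ⊢
    rw [h2] at h1
    linarith
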